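/- \textbf{SAS+ planning.} A \emph{SAS+ instance} is a tuple $\langle V,D,A,I,G\rangle$ with a finite set $V$ of variables, a finite domain $D$, a finite set $A$ of actions, an initial state $I\in D^V$ and a goal $G\in (D\cup\{\mathbf u\})^V$, where $\mathbf u\notin D$ stands for "undefined". Each action $a$ has a precondition $\mathrm{pre}(a)$ and an effect $\mathrm{eff}(a)$ in $(D\cup\{\mathbf u\})^V$. The action $a$ is \emph{valid} in a state $s\in D^V$ if for all $v\in V$ either $\mathrm{pre}(a)[v]=s[v]$ or $\mathrm{pre}(a)[v]=\mathbf u$; its \emph{result} in $s$ is the state that has the value $\mathrm{eff}(a)[v]$ at each $v$ with $\mathrm{eff}(a)[v]\neq\mathbf u$ and the value $s[v]$ at every other $v$. A \emph{plan} is a finite sequence of actions that can be executed one after the other from $I$, each being valid in the state in which it is executed, such that the final state $s$ satisfies $G[v]\in\{s[v],\mathbf u\}$ for all $v\in V$. The instance satisfies \emph{restriction U} if for every $a\in A$ there is exactly one $v\in V$ with $\mathrm{eff}(a)[v]\neq\mathbf u$. \emph{Bounded SAS+ planning under restriction U} is the parameterized problem whose instances are the pairs of a SAS+ instance that satisfies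 U and a positive integer $k$; the parameter is $k$, and the question is whether there is a plan of length at most $k$. \textbf{W[1].} A parameterized problem $L$ \emph{reduces} to a parameterized problem $L'$ if there is a map $R$ from the instances of $L$ to the instances of $L'$ such that (1) $x$ is a yes-instance of $L$ if and only if $R(x)$ is a yes-instance of $L'$; (2) for some computable $g$, the parameter of $R(x)$ is at most $g(k)$, where $k$ is the parameter of $x$; (3) for some computable $f$ and some constant $c$, $R$ is computed by a (multi-stack) Turing machine in at most $f(k)\cdot n^c$ steps, where $n$ is the size of $x$ (the length of its code). \emph{W[1]} is the class of all parameterized problems that reduce, for some constant $q$, to the problem: given a formula in conjunctive normal form with at most $q$ literals per clause and a number $k$ (the parameter), is there a satisfying assignment that sets exactly $k$ variables to true? \textbf{Theorem.} Bounded SAS+ planning under restriction U is in W[1]. -/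

import Mathlib

namespace BoundedPlanning

/-! ## SAS+ planning -/

/-- A total state over variables `V` and domain `D`. -/
abbrev State (V D : Type) := V → D

/-- A partial state over `V` and `D`; `none` is the undefined value. -/
abbrev PartialState (V D : Type) := V → Option D

/-- A SAS+ instance with variables `V`, domain `D` and actions `A`. -/
structure SASPlus (V D A : Type) where
  pre : A → PartialState V D
  eff : A → PartialState V D
  init : State V D
  goal : PartialState V D

namespace SASPlus

variable {V D A : Type}

/-- `s` agrees with the partial state `p` wherever `p` is defined. -/
def Satisfies (s : State V D) (p : PartialState V D) : Prop :=
  ∀ v, p v = some (s v) ∨ p v = none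

/-- Action `a` is valid in the state `s`. -/
def Valid (I : SASPlus V D A) (a : A) (s : State V D) : Prop :=
  Satisfies s (I.pre a)

/-- The result of the action `a` in the state `s`. -/
def result (I : SASPlus V D A) (a : A) (s : State V D) : State V D :=
  fun v => (I.eff a v).getD (s v)

/-- The action sequence is a plan from the first state to the second one. -/
def IsPlanFromTo (I : SASPlus V D A) : State V D → List A → State V D → Prop
  | s, [], t => s = t
  | s, a :: as, t => I.Valid a s ∧ I.IsPlanFromTo (I.result a s) as t

/-- A plan for the instance: a plan from the initial state to some goal state. -/
def IsPlan (I : SASPlus V D A) (π : List A) : Prop :=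
  ∃ t, Satisfies t I.goal ∧ I.IsPlanFromTo I.init π t

/-- Restriction U: every action has an effect on exactly one variable. -/
def RestrictionU (I : SASPlus V D A) : Prop :=
  ∀ a, ∃! v, I.eff a v ≠ none

end SASPlus

/-! ## Codings of finite objects as bit strings -/

/-- Self-delimiting coding of a list of numbers: each number in unary, ended by `false`. -/
def bits (l : List ℕ) : List Bool :=
  l.flatMap fun n => List.replicate n true ++ [false]

/-- `f` is a uniquely decodable prefix coding. -/
def PrefixCode {α β : Type} (f : α → List β) : Prop :=
  ∀ a b s t, f a ++ s = f b ++ t → a = b ∧ s = t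

theorem PrefixCode.injective {α β : Type} {f : α → List β} (h : PrefixCode f) :
    Function.Injective f := fun a b hab => (h a b [] [] (by rw [hab])).1

theorem bits_injective : Function.Injective bits := by
  intro l
  induction l with
  | nil =>
    intro m h
    cases m with
    | nil => rfl
    | cons b m => simp [bits] at h
  | cons a l ih =>
    intro m h
    cases m with
    | nil => simp [bits] at h
    | cons b m =>
      have key : ∀ a b : ℕ, ∀ s t : List Bool,
          List.replicate a true ++ false :: s = List.replicate b true ++ false :: t →
          a = b ∧ s = t := by
        intro a
        induction a with
        | zero => intro b s t h; cases b <;> simp_all [List.replicate_succ]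
        | succ a ih =>
          intro b s t h
          cases b with
          | zero => simp [List.replicate_succ] at h
          | succ b =>
            simp only [List.replicate_succ, List.cons_append, List.cons.injEq, true_and] at h
            have := ih b s t h
            exact ⟨by omega, this.2⟩
      have h' := key a b (bits l) (bits m) (by simpa [bits] using h)
      rw [h'.1, ih h'.2]

/-- Coding of an element of `Option (Fin d)`: `0` for `none`, `x + 1` for `some x`. -/
def codeOption {d : ℕ} : Option (Fin d) → ℕ
  | none => 0
  | some x => x + 1

theorem codeOption_injective {d : ℕ} : Function.Injective (codeOption (d := d)) := by
  intro a b h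
  cases a <;> cases b <;> simp_all [codeOption, Fin.ext_iff]

/-- A list is coded by its length followed by the codes of its members. -/
def codeList {α : Type} (f : α → List ℕ) (l : List α) : List ℕ :=
  l.length :: l.flatMap f

theorem PrefixCode.codeList {α : Type} {f : α → List ℕ} (hf : PrefixCode f) :
    PrefixCode (codeList f) := by
  intro a
  induction a with
  | nil =>
    intro b s t h
    cases b with
    | nil => simpa [BoundedPlanning.codeList] using h
    | cons b l => simp [BoundedPlanning.codeList] at h
  | cons a as ih =>
    intro b s t h
    cases b with
    | nil => simp [BoundedPlanning.codeList] at h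
    | cons b bs =>
      simp only [BoundedPlanning.codeList, List.length_cons, List.flatMap_cons, List.cons_append,
        List.cons.injEq, List.append_assoc, Nat.add_right_cancel_iff] at h
      obtain ⟨rfl, h2⟩ := hf _ _ _ _ h.2
      obtain ⟨rfl, h3⟩ := ih bs s t (by simp [BoundedPlanning.codeList, h.1, h2])
      exact ⟨rfl, h3⟩

/-! ## Parameterized problems, parameterized reductions -/

/-- A parameterized decision problem. `code` is the coding of the instances as bit strings; the
size of an instance is the length of its code. -/
structure ParamProblem where
  Instance : Type
  code : Instance → List Bool
  code_injective : Function.Injective code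
  param : Instance → ℕ
  IsYes : Instance → Prop

/-- The size of an instance. -/
def ParamProblem.size (P : ParamProblem) (x : P.Instance) : ℕ := (P.code x).length

/-- The Turing machine `M`, with stacks over finite alphabets, started on `input`, halts with
`output` after at most `T` steps. -/
def OutputsWithin (M : Turing.TM2ComputableAux Bool Bool) (input output : List Bool) (T : ℕ) :
    Prop :=
  Nonempty (Turing.TM2OutputsInTime M.tm (input.map M.inputAlphabet.symm)
    (some (output.map M.outputAlphabet.symm)) T)

/-- `R` can be computed by a Turing machine in time `f(k) * n ^ c` with `f` computable, where `k`
is the parameter and `n` the size of the instance. -/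
def FPTComputable {P Q : ParamProblem} (R : P.Instance → Q.Instance) : Prop :=
  ∃ M : Turing.TM2ComputableAux Bool Bool, (∀ i, Finite (M.tm.Γ i)) ∧
    ∃ (f : ℕ → ℕ) (c : ℕ), Computable f ∧
      ∀ x, OutputsWithin M (P.code x) (Q.code (R x)) (f (P.param x) * P.size x ^ c)

/-- `P` reduces to `Q` by a parameterized reduction. -/
def FPTReducible (P Q : ParamProblem) : Prop :=
  ∃ R : P.Instance → Q.Instance,
    (∀ x, P.IsYes x ↔ Q.IsYes (R x)) ∧
    (∃ g : ℕ → ℕ, Computable g ∧ ∀ x, Q.param (R x) ≤ g (P.param x)) ∧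
    FPTComputable R

/-! ## Weighted satisfiability and the class W[1] -/

/-- A propositional formula in conjunctive normal form over the variables `0, …, N - 1`: a list of
clauses, each a list of literals; the literal `(x, true)` is `x` and `(x, false)` is `¬ x`. -/
abbrev CNF (N : ℕ) := List (List (Fin N × Bool))

/-- The truth assignment `τ` satisfies the formula. -/
def CNF.SatisfiedBy {N : ℕ} (φ : CNF N) (τ : Fin N → Bool) : Prop :=
  ∀ C ∈ φ, ∃ l ∈ C, τ l.1 = l.2

/-- A formula in CNF together with a number `k`. -/
structure WeightedSATInstance where
  numVars : ℕ
  formula : CNF numVars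
  k : ℕ

namespace WeightedSATInstance

/-- There is a satisfying assignment that sets exactly `k` variables to true. -/
def Solvable (x : WeightedSATInstance) : Prop :=
  ∃ τ : Fin x.numVars → Bool, x.formula.SatisfiedBy τ ∧
    (Finset.univ.filter fun i => τ i = true).card = x.k

/-- Coding of a literal. -/
def codeLiteral {N : ℕ} (l : Fin N × Bool) : List ℕ := [l.1, l.2.toNat]

def code (x : WeightedSATInstance) : List Bool :=
  bits (x.numVars :: x.k :: codeList (codeList codeLiteral) x.formula)

theorem code_injective : Function.Injective code := by
  intro x y h
  have hl : ∀ N, PrefixCode (codeLiteral (N := N)) := by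
    rintro N ⟨a, p⟩ ⟨b, q⟩ s t h
    simp only [codeLiteral, List.cons_append, List.nil_append, List.cons.injEq] at h
    obtain ⟨h1, h2, h3⟩ := h
    refine ⟨Prod.ext (Fin.ext h1) ?_, h3⟩
    cases p <;> cases q <;> simp_all
  replace h := bits_injective h
  obtain ⟨N, φ, k⟩ := x
  obtain ⟨N', φ', k'⟩ := y
  simp only [List.cons.injEq] at h
  obtain ⟨rfl, rfl, h⟩ := h
  rw [(hl N).codeList.codeList.injective h]

end WeightedSATInstance

/-- Weighted satisfiability of formulas in CNF with at most `q` literals in each clause, with the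
weight as the parameter. -/
def weightedCNFSat (q : ℕ) : ParamProblem where
  Instance := {x : WeightedSATInstance // ∀ C ∈ x.formula, C.length ≤ q}
  code x := x.1.code
  code_injective := WeightedSATInstance.code_injective.comp Subtype.val_injective
  param x := x.1.k
  IsYes x := x.1.Solvable

/-- The class W[1]: the parameterized problems that have a parameterized reduction to the weighted
satisfiability problem for formulas in CNF with clauses of bounded size. -/
def W1 : Set ParamProblem := {P | ∃ q : ℕ, FPTReducible P (weightedCNFSat q)}

/-! ## Bounded SAS+ planning -/

/-- An instance of bounded SAS+ planning: a SAS+ instance with `n` variables, a domain of size `d`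
and `m` actions, and a positive integer `k`. -/
structure PlanningInstance where
  n : ℕ
  d : ℕ
  m : ℕ
  plan : SASPlus (Fin n) (Fin d) (Fin m)
  k : ℕ
  k_pos : 0 < k

namespace PlanningInstance

/-- There is a plan of length at most `k`. -/
def Solvable (x : PlanningInstance) : Prop :=
  ∃ π : List (Fin x.m), π.length ≤ x.k ∧ x.plan.IsPlan π

/-- Coding of a partial state as the list of its values. -/
def codePartial {n d : ℕ} (p : PartialState (Fin n) (Fin d)) : List ℕ :=
  List.ofFn fun v => codeOption (p v)

/-- The numbers `n`, `d`, `m`, `k`, then the initial state, the goal, and, for each action in turn,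
its precondition and its effect. -/
def code (x : PlanningInstance) : List Bool :=
  bits (x.n :: x.d :: x.m :: x.k :: (codePartial (fun v => some (x.plan.init v)) ++
    (codePartial x.plan.goal ++
      (List.ofFn fun a => codePartial (x.plan.pre a) ++ codePartial (x.plan.eff a)).flatten)))

theorem codePartial_prefixCode (n d : ℕ) : PrefixCode (codePartial (n := n) (d := d)) := by
  intro p q s t h
  obtain ⟨h1, h2⟩ := List.append_inj h (by simp [codePartial])
  refine ⟨?_, h2⟩
  have h3 := List.ofFn_injective h1
  funext v
  exact codeOption_injective (congrFun h3 v)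

theorem code_injective : Function.Injective code := by
  intro x y h
  replace h := bits_injective h
  obtain ⟨n, d, m, ⟨pr, ef, ini, go⟩, k, hk⟩ := x
  obtain ⟨n', d', m', ⟨pr', ef', ini', go'⟩, k', hk'⟩ := y
  simp only [List.cons.injEq] at h
  obtain ⟨rfl, rfl, rfl, rfl, h⟩ := h
  obtain ⟨h1, hg⟩ := codePartial_prefixCode _ _ _ _ _ _ h
  obtain ⟨h0, ha⟩ := codePartial_prefixCode _ _ _ _ _ _ hg
  have h1 : ini = ini' := by
    funext v
    simpa using congrFun h1 v
  have hb := List.ofFn_injective (List.eq_iff_flatten_eq.2 ⟨ha, by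
    simp [List.map_ofFn, Function.comp_def, codePartial]⟩)
  have h2 : ∀ a, pr a = pr' a ∧ ef a = ef' a := by
    intro a
    obtain ⟨e1, e2⟩ := codePartial_prefixCode _ _ _ _ _ _ (congrFun hb a)
    exact ⟨e1, (codePartial_prefixCode _ _).injective e2⟩
  have h3 : pr = pr' := funext fun a => (h2 a).1
  have h4 : ef = ef' := funext fun a => (h2 a).2
  subst h0 h1 h3 h4
  rfl

end PlanningInstance

/-- Bounded SAS+ planning for the instances that satisfy the restriction `R`, with the bound on the
plan length as the parameter. -/
def boundedSASPlanning (R : PlanningInstance → Prop) : ParamProblem where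
  Instance := {x : PlanningInstance // R x}
  code x := x.1.code
  code_injective := PlanningInstance.code_injective.comp Subtype.val_injective
  param x := x.1.k
  IsYes x := x.1.Solvable

end BoundedPlanning

/-! Under restriction U a plan of length at most `k` changes at most `k` variables. It is therefore
described by quadratically many choices in `k`: an action or no action at each of `k` times, a list
of tracked variables that contains all changed ones, and the value of each tracked variable at each
of `k + 1` times. Each choice is a slot with one of `numValues` values, and a propositional variable
says that a given slot has a given value. The weight is the number of slots and `uniqueClauses`
forbids two values in one slot, so a solution is exactly one value per slot
(`satInstance_solvable_iff`). Every other clause is purely negative too and forbids one combination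
of at most four slot values.

The difficulty is the untracked variables: preconditions and the goal may mention all of them, while
clauses have bounded size. An untracked variable should keep its initial value, so no chosen action
may affect it, and no chosen precondition or the goal may ask for another value. The tracked
variables are listed between the sentinels `0` and `n + 1`, and in increasing order an untracked
variable lies strictly between two neighbours. Hence the conditions `GoalGap` and `ActGap` involve
only two adjacent tracking slots, and for `ActGap` one action slot; the search through the gap is
done by the reduction, not by the formula. For soundness the order need not be enforced, because by
`exists_gap` a sequence from `0` to `n + 1` that misses a number steps over it. Tracked variables
are followed by ordinary precondition, effect and frame clauses; the frame clauses need four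
literals.

`PlanConstraints.solvable` extracts a plan from the slot values. `exists_planConstraints` goes back;
this is where restriction U enters, to bound the number of affected variables.

The running time is proved for an actual machine. Structured stack programs are compiled with their
continuations as labels (`Exec.run`, `exists_machine`). The predicates `Comp` and `Emit` are closed
under arithmetic, input lookup, branching, bounded sums and bounded iteration, so `emitClauses_all`
only follows the syntax of the clause lists. Since numbers are coded in unary, every number in the
input is bounded by the input size. -/

namespace BoundedPlanning

/-! ## Structured programs over stacks and their compilation to Turing machines -/

/-- A structured program over stacks of bits that are indexed by the natural numbers. -/
inductive StackProg
  | push (k : ℕ) (b : Bool)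
  | pop (k : ℕ)
  | seq (p q : StackProg)
  | loop (k : ℕ) (c : Option Bool → Bool) (p : StackProg)
  | ite (k : ℕ) (c : Option Bool → Bool) (p q : StackProg)

namespace StackProg

/-- The contents of the stacks. -/
abbrev Stacks := ℕ → List Bool

/-- `Exec p s s' t`: the program `p` leads from `s` to `s'` in `t` steps. -/
inductive Exec : StackProg → Stacks → Stacks → ℕ → Prop
  | push (k b s) : Exec (push k b) s (Function.update s k (b :: s k)) 1
  | pop (k s) : Exec (pop k) s (Function.update s k (s k).tail) 1
  | seq {p q s s₁ s₂ t₁ t₂} : Exec p s s₁ t₁ → Exec q s₁ s₂ t₂ → Exec (seq p q) s s₂ (t₁ + t₂ + 1)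
  | loopDone {k c p s} : c (s k).head? = false → Exec (loop k c p) s s 1
  | loopStep {k c p s s₁ s₂ t₁ t₂} : c (s k).head? = true → Exec p s s₁ t₁ →
      Exec (loop k c p) s₁ s₂ t₂ → Exec (loop k c p) s s₂ (t₁ + t₂ + 1)
  | iteTrue {k c p q s s₁ t} : c (s k).head? = true → Exec p s s₁ t → Exec (ite k c p q) s s₁ (t + 1)
  | iteFalse {k c p q s s₁ t} : c (s k).head? = false → Exec q s s₁ t →
      Exec (ite k c p q) s s₁ (t + 1)

/-- The continuations that are met when `p` is run with the continuation `r`, except for `r`. -/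
def conts : StackProg → List StackProg → Set (List StackProg)
  | push k b, r => {push k b :: r}
  | pop k, r => {pop k :: r}
  | seq p q, r => {seq p q :: r} ∪ conts p (q :: r) ∪ conts q r
  | loop k c p, r => {loop k c p :: r} ∪ conts p (loop k c p :: r)
  | ite k c p q, r => {ite k c p q :: r} ∪ conts p r ∪ conts q r

/-- A loop body returns to the loop itself, so unrolling creates no new continuations. Finiteness is
what allows continuations to serve as machine labels. -/
theorem conts_finite (p : StackProg) : ∀ r, (conts p r).Finite := by
  induction p with
  | push | pop => intro r; exact Set.finite_singleton _
  | seq p q hp hq => intro r; exact ((Set.finite_singleton _).union (hp _)).union (hq _)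
  | loop k c p hp => intro r; exact (Set.finite_singleton _).union (hp _)
  | ite k c p q hp hq => intro r; exact ((Set.finite_singleton _).union (hp _)).union (hq _)

theorem mem_conts (p : StackProg) (r : List StackProg) : p :: r ∈ conts p r := by
  cases p <;> simp [conts]

/-- All stacks of the program have an index below `N`. -/
def UsesBelow (N : ℕ) : StackProg → Prop
  | push k _ => k < N
  | pop k => k < N
  | seq p q => UsesBelow N p ∧ UsesBelow N q
  | loop k _ p => k < N ∧ UsesBelow N p
  | ite k _ p q => k < N ∧ UsesBelow N p ∧ UsesBelow N q

theorem UsesBelow.mono {N M : ℕ} (h : N ≤ M) {p : StackProg} (hp : UsesBelow N p) :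
    UsesBelow M p := by
  induction p with
  | push | pop => exact lt_of_lt_of_le hp h
  | seq p q ihp ihq => exact ⟨ihp hp.1, ihq hp.2⟩
  | loop k c p ihp => exact ⟨hp.1.trans_le h, ihp hp.2⟩
  | ite k c p q ihp ihq => exact ⟨hp.1.trans_le h, ihp hp.2.1, ihq hp.2.2⟩

theorem exists_usesBelow (p : StackProg) : ∃ N, UsesBelow N p := by
  induction p with
  | push k | pop k => exact ⟨k + 1, Nat.lt_succ_self k⟩
  | seq p q hp hq =>
    obtain ⟨N, hN⟩ := hp
    obtain ⟨M, hM⟩ := hq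
    exact ⟨max N M, hN.mono (le_max_left _ _), hM.mono (le_max_right _ _)⟩
  | loop k c p hp =>
    obtain ⟨N, hN⟩ := hp
    exact ⟨max N (k + 1), lt_of_lt_of_le (Nat.lt_succ_self k) (le_max_right _ _),
      hN.mono (le_max_left _ _)⟩
  | ite k c p q hp hq =>
    obtain ⟨N, hN⟩ := hp
    obtain ⟨M, hM⟩ := hq
    exact ⟨max (max N M) (k + 1), lt_of_lt_of_le (Nat.lt_succ_self k) (le_max_right _ _),
      hN.mono ((le_max_left _ _).trans (le_max_left _ _)),
      hM.mono ((le_max_right _ _).trans (le_max_left _ _))⟩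

/-! ### Compilation of stack programs. -/

section Machine

variable (N : ℕ) (S : Set (List StackProg))

open Classical in
/-- Jump to the continuation `r`. -/
noncomputable def jump (r : List StackProg) : Turing.TM2.Stmt (fun _ : Fin N => Bool) S (Option Bool) :=
  if h : r ∈ S then .load (fun _ => none) (.goto fun _ => ⟨r, h⟩) else .halt

/-- The statement that executes the first instruction of a continuation. -/
noncomputable def stmt : List StackProg → Turing.TM2.Stmt (fun _ : Fin N => Bool) S (Option Bool)
  | [] => .halt
  | push k b :: r => if h : k < N then .push ⟨k, h⟩ (fun _ => b) (jump N S r) else .halt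
  | pop k :: r => if h : k < N then .pop ⟨k, h⟩ (fun v _ => v) (jump N S r) else .halt
  | seq p q :: r => jump N S (p :: q :: r)
  | loop k c p :: r =>
    if h : k < N then .peek ⟨k, h⟩ (fun _ o => o)
      (.branch (fun v => c v) (jump N S (p :: loop k c p :: r)) (jump N S r)) else .halt
  | ite k c p q :: r =>
    if h : k < N then .peek ⟨k, h⟩ (fun _ o => o)
      (.branch (fun v => c v) (jump N S (p :: r)) (jump N S (q :: r))) else .halt

/-- The configuration with the continuation `r` and the stack contents `s`. -/
def config (r : S) (s : Stacks) : Turing.TM2.Cfg (fun _ : Fin N => Bool) S (Option Bool) :=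
  ⟨some r, none, fun i => s i⟩

variable {N S}

/-- Each jump resets the internal variable to `none`, so between instructions a configuration
depends only on the continuation and the stacks. -/
theorem stepAux_jump {r : List StackProg} (h : r ∈ S) (v : Option Bool) (s : Stacks) :
    Turing.TM2.stepAux (jump N S r) v (fun i : Fin N => s i) = config N S ⟨r, h⟩ s := by
  simp [jump, h, config]

theorem update_fin (s : Stacks) (k : ℕ) (h : k < N) (l : List Bool) :
    Function.update (fun i : Fin N => s i) ⟨k, h⟩ l =
      fun i : Fin N => Function.update s k l i := by
  funext i
  by_cases hi : i = ⟨k, h⟩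
  · subst hi; simp
  · have : (i : ℕ) ≠ k := fun e => hi (Fin.ext e)
    simp [hi, this]

/-- Iterating the step function of the machine. -/
noncomputable def run (N : ℕ) (S : Set (List StackProg)) (t : ℕ) :=
  (flip bind (Turing.TM2.step (fun l : S => stmt N S l.1)))^[t]

theorem run_one (l : S) (s : Stacks) :
    run N S 1 (some (config N S l s)) =
      some (Turing.TM2.stepAux (stmt N S l.1) none (fun i : Fin N => s i)) := by
  rfl

theorem run_add (t₁ t₂ : ℕ) (c) : run N S (t₁ + t₂) c = run N S t₁ (run N S t₂ c) :=
  Function.iterate_add_apply _ _ _ _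

/-- Induction on the execution, uniformly in `r`: the parts of `seq` and `loop` run with longer
continuations, which `conts` provides for. -/
theorem Exec.run {p : StackProg} {s s' : Stacks} {t : ℕ} (h : Exec p s s' t) (hN : UsesBelow N p) :
    ∀ r (hr : r ∈ S) (_hS : conts p r ⊆ S) (hpr : p :: r ∈ S),
      run N S t (some (config N S ⟨p :: r, hpr⟩ s)) =
        some (config N S ⟨r, hr⟩ s') := by
  induction h with
  | push k b s =>
    intro r hr hS hpr
    rw [run_one]
    have hN : k < N := hN
    simp only [stmt, hN, dif_pos, Turing.TM2.stepAux]
    rw [update_fin, stepAux_jump hr]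
  | pop k s =>
    intro r hr hS hpr
    rw [run_one]
    have hN : k < N := hN
    simp only [stmt, hN, dif_pos, Turing.TM2.stepAux]
    rw [update_fin, stepAux_jump hr]
  | @seq p q s s₁ s₂ t₁ t₂ hp hq ihp ihq =>
    intro r hr hS hpr
    have hq' : conts q r ⊆ S := fun x hx => hS (by simp [conts, hx])
    have hp' : conts p (q :: r) ⊆ S := fun x hx => hS (by simp [conts, hx])
    -- `run_add` performs its second summand first: the dispatch step, then `p`, then `q`.
    have e : t₁ + t₂ + 1 = t₂ + (t₁ + 1) := by omega
    rw [e, run_add, run_add, run_one]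
    simp only [stmt]
    rw [stepAux_jump (hp' (mem_conts p _)), ihp hN.1 _ (hq' (mem_conts q r)) hp',
      ihq hN.2 _ hr hq']
  | @loopDone k c p s hc =>
    intro r hr hS hpr
    rw [run_one]
    have hk : k < N := hN.1
    simp only [stmt, hk, dif_pos, Turing.TM2.stepAux, hc, cond_false]
    rw [stepAux_jump hr]
  | @loopStep k c p s s₁ s₂ t₁ t₂ hc hp hq ihp ihq =>
    intro r hr hS hpr
    have hp' : conts p (loop k c p :: r) ⊆ S := fun x hx => hS (by simp [conts, hx])
    have e : t₁ + t₂ + 1 = t₂ + (t₁ + 1) := by omega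
    have hk : k < N := hN.1
    rw [e, run_add, run_add, run_one]
    simp only [stmt, hk, dif_pos, Turing.TM2.stepAux, hc, cond_true]
    rw [stepAux_jump (hp' (mem_conts p _)), ihp hN.2 _ hpr hp',
      ihq hN _ hr hS]
  | @iteTrue k c p q s s₁ t hc hp ihp =>
    intro r hr hS hpr
    have hp' : conts p r ⊆ S := fun x hx => hS (by simp [conts, hx])
    have hk : k < N := hN.1
    rw [run_add, run_one]
    simp only [stmt, hk, dif_pos, Turing.TM2.stepAux, hc, cond_true]
    rw [stepAux_jump (hp' (mem_conts p _)), ihp hN.2.1 _ hr hp']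
  | @iteFalse k c p q s s₁ t hc hp ihp =>
    intro r hr hS hpr
    have hp' : conts q r ⊆ S := fun x hx => hS (by simp [conts, hx])
    have hk : k < N := hN.1
    rw [run_add, run_one]
    simp only [stmt, hk, dif_pos, Turing.TM2.stepAux, hc, cond_false]
    rw [stepAux_jump (hp' (mem_conts q _)), ihp hN.2.2 _ hr hp']

end Machine

/-- The labels of the machine for the program `p`. -/
def labels (p : StackProg) : Set (List StackProg) := insert [] (conts p [])

noncomputable instance (p : StackProg) : Fintype (labels p) :=
  ((conts_finite p []).insert []).fintype

/-- The Turing machine for the program `p`, with `N + 2` stacks. The input is on the stack `0` and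
the output is on the stack `1`. -/
noncomputable def machine (p : StackProg) (N : ℕ) : Turing.TM2ComputableAux Bool Bool where
  tm :=
    { K := Fin (N + 2)
      k₀ := 0
      k₁ := 1
      Γ := fun _ => Bool
      Λ := labels p
      main := ⟨[p], Or.inr (mem_conts p [])⟩
      σ := Option Bool
      initialState := none
      Γk₀Fin := inferInstanceAs (Fintype Bool)
      m := fun l => stmt (N + 2) (labels p) l.1 }
  inputAlphabet := Equiv.refl Bool
  outputAlphabet := Equiv.refl Bool

/-- A program that leaves nothing but its output can be run by a Turing machine. -/
theorem exists_machine (p : StackProg) : ∃ M : Turing.TM2ComputableAux Bool Bool,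
    (∀ i, Finite (M.tm.Γ i)) ∧ ∀ (input output : List Bool) (t T : ℕ),
      Exec p (Function.update (fun _ => []) 0 input) (Function.update (fun _ => []) 1 output) t →
      t + 1 ≤ T → OutputsWithin M input output T := by
  obtain ⟨N, hN⟩ := exists_usesBelow p
  refine ⟨machine p N, fun i => inferInstanceAs (Finite Bool), ?_⟩
  intro input output t T h hT
  -- The extra step executes the empty continuation, which halts.
  refine ⟨⟨⟨1 + t, ?_⟩, (by omega : 1 + t ≤ T)⟩⟩
  have h1 := h.run (S := labels p) (hN.mono (Nat.le_add_right N 2)) [] (Or.inl rfl)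
    (fun x hx => Or.inr hx) (Or.inr (mem_conts p []))
  have h0 : Turing.initList (machine p N).tm (input.map (machine p N).inputAlphabet.symm) =
      config (N + 2) (labels p) ⟨[p], Or.inr (mem_conts p [])⟩
        (Function.update (fun _ => []) 0 input) := by
    simp only [Turing.initList, config, machine]
    congr 1
    funext i
    by_cases hi : i = 0
    · subst hi; simp; exact List.map_id _
    · have : (i : ℕ) ≠ 0 := fun e => hi (Fin.ext e)
      simp [hi, this]
  have h2 : Turing.haltList (machine p N).tm (output.map (machine p N).outputAlphabet.symm) =
      ⟨none, none, fun i : Fin (N + 2) => Function.update (fun _ => []) 1 output (i : ℕ)⟩ := by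
    simp only [Turing.haltList, machine]
    congr 1
    funext i
    by_cases hi : i = 1
    · subst hi; simp; exact List.map_id _
    · have : (i : ℕ) ≠ 1 := fun e => hi (Fin.ext e)
      simp [hi, this]
  rw [h0, Option.map_some, h2]
  exact (run_add 1 t _).trans (congrArg (run (N + 2) (labels p) 1) h1)

end StackProg

/-! ## Polynomial bounds -/

/-- `T` is bounded by a polynomial. -/
def PolyBounded (T : ℕ → ℕ) : Prop := ∃ c, ∀ B, T B ≤ (B + 2) ^ c

namespace PolyBounded

variable {S T : ℕ → ℕ}

/-- The base `B + 2` is at least 2, so a single power absorbs constants and, in `add`, one more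
factor absorbs a sum; no coefficients are needed. -/
theorem const (a : ℕ) : PolyBounded fun _ => a :=
  ⟨a, fun B => (Nat.lt_pow_self (by omega : 1 < B + 2)).le⟩

theorem id : PolyBounded fun B => B := ⟨1, fun B => by simp⟩

theorem mul (hS : PolyBounded S) (hT : PolyBounded T) : PolyBounded fun B => S B * T B := by
  obtain ⟨c, hc⟩ := hS
  obtain ⟨d, hd⟩ := hT
  exact ⟨c + d, fun B => by rw [pow_add]; exact Nat.mul_le_mul (hc B) (hd B)⟩

theorem add (hS : PolyBounded S) (hT : PolyBounded T) : PolyBounded fun B => S B + T B := by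
  obtain ⟨c, hc⟩ := hS
  obtain ⟨d, hd⟩ := hT
  refine ⟨c + d + 1, fun B => ?_⟩
  have h1 : (B + 2) ^ c ≤ (B + 2) ^ (c + d) := Nat.pow_le_pow_right (by omega) (by omega)
  have h2 : (B + 2) ^ d ≤ (B + 2) ^ (c + d) := Nat.pow_le_pow_right (by omega) (by omega)
  have h3 : (B + 2) ^ (c + d) * 2 ≤ (B + 2) ^ (c + d) * (B + 2) :=
    Nat.mul_le_mul_left _ (by omega)
  rw [pow_succ]
  have := hc B
  have := hd B
  change S B + T B ≤ _
  nlinarith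

theorem comp (hT : PolyBounded T) (hS : PolyBounded S) : PolyBounded fun B => T (S B) := by
  obtain ⟨c, hc⟩ := hS.add (const 2)
  obtain ⟨d, hd⟩ := hT
  exact ⟨c * d, fun B => (hd _).trans (by rw [pow_mul]; exact Nat.pow_le_pow_left (hc B) d)⟩

end PolyBounded

/-! ## Running stack programs with unary registers -/

namespace StackProg

/-- The program `p` leads from `s` to `s'` in at most `T` steps. -/
def Runs (p : StackProg) (s s' : Stacks) (T : ℕ) : Prop := ∃ t ≤ T, Exec p s s' t

namespace Runs

variable {p q : StackProg} {s s₁ s₂ : Stacks} {T T₁ T₂ : ℕ}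

theorem mono (h : Runs p s s₁ T₁) (hT : T₁ ≤ T₂) : Runs p s s₁ T₂ := by
  obtain ⟨t, ht, h⟩ := h
  exact ⟨t, ht.trans hT, h⟩

theorem seq (hp : Runs p s s₁ T₁) (hq : Runs q s₁ s₂ T₂) :
    Runs (.seq p q) s s₂ (T₁ + T₂ + 1) := by
  obtain ⟨t₁, h₁, hp⟩ := hp
  obtain ⟨t₂, h₂, hq⟩ := hq
  exact ⟨_, by omega, hp.seq hq⟩

theorem push (k : ℕ) (b : Bool) (s : Stacks) :
    Runs (.push k b) s (Function.update s k (b :: s k)) 1 := ⟨1, le_rfl, .push k b s⟩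

theorem pop (k : ℕ) (s : Stacks) : Runs (.pop k) s (Function.update s k (s k).tail) 1 :=
  ⟨1, le_rfl, .pop k s⟩

theorem iteTrue {k c} (hc : c (s k).head? = true) (hp : Runs p s s₁ T) :
    Runs (.ite k c p q) s s₁ (T + 1) := by
  obtain ⟨t, h, hp⟩ := hp
  exact ⟨_, by omega, hp.iteTrue hc⟩

theorem iteFalse {k c} (hc : c (s k).head? = false) (hq : Runs q s s₁ T) :
    Runs (.ite k c p q) s s₁ (T + 1) := by
  obtain ⟨t, h, hq⟩ := hq
  exact ⟨_, by omega, hq.iteFalse hc⟩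

/-- A loop invariant in explicit form: `σ j` is the state at the test that precedes round `j`. -/
theorem loop {k c} (σ : ℕ → Stacks) (N : ℕ) (hN : c (σ N k).head? = false)
    (h : ∀ j < N, c (σ j k).head? = true ∧ Runs p (σ j) (σ (j + 1)) T) :
    Runs (.loop k c p) (σ 0) (σ N) (N * (T + 1) + 1) := by
  induction N generalizing σ with
  | zero => exact ⟨1, by omega, .loopDone hN⟩
  | succ N ih =>
    obtain ⟨t₁, h₁, e₁⟩ := ih (fun j => σ (j + 1)) hN fun j hj => h (j + 1) (by omega)
    obtain ⟨hc, t, ht, e⟩ := h 0 (by omega)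
    exact ⟨_, by rw [Nat.succ_mul]; omega, .loopStep hc e e₁⟩

end Runs

/-- The stacks `0`, `1`, `2` have the given contents and the stack `i + 3` holds the number `r i`
in unary. -/
def mem (a b c : List Bool) (r : ℕ → ℕ) : Stacks
  | 0 => a
  | 1 => b
  | 2 => c
  | i + 3 => List.replicate (r i) true

/-! ### Arithmetic on unary registers. -/

section mem

variable (a b c : List Bool) (r : ℕ → ℕ)

@[simp] theorem mem_zero : mem a b c r 0 = a := rfl
@[simp] theorem mem_one : mem a b c r 1 = b := rfl
@[simp] theorem mem_two : mem a b c r 2 = c := rfl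
@[simp] theorem mem_reg (i : ℕ) : mem a b c r (i + 3) = List.replicate (r i) true := rfl

@[simp] theorem update_mem_zero (l : List Bool) :
    Function.update (mem a b c r) 0 l = mem l b c r := by
  funext k
  match k with
  | 0 | 1 | 2 | i + 3 => simp [mem, Function.update]

@[simp] theorem update_mem_one (l : List Bool) :
    Function.update (mem a b c r) 1 l = mem a l c r := by
  funext k
  match k with
  | 0 | 1 | 2 | i + 3 => simp [mem, Function.update]

@[simp] theorem update_mem_two (l : List Bool) :
    Function.update (mem a b c r) 2 l = mem a b l r := by
  funext k
  match k with
  | 0 | 1 | 2 | i + 3 => simp [mem, Function.update]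

theorem update_mem_reg (i n : ℕ) :
    Function.update (mem a b c r) (i + 3) (List.replicate n true) =
      mem a b c (Function.update r i n) := by
  funext k
  match k with
  | 0 | 1 | 2 => simp [mem, Function.update]
  | j + 3 =>
    by_cases h : j = i
    · subst h; simp [mem]
    · simp [mem, h]

variable {a b c r} in
theorem Runs.conv {p : StackProg} {s : Stacks} {r' : ℕ → ℕ} {T T' : ℕ}
    (h : Runs p s (mem a b c r) T) (hr : r = r') (hT : T ≤ T') : Runs p s (mem a b c r') T' :=
  hr ▸ h.mono hT

/-- Increment a register. -/
def inc (i : ℕ) : StackProg := push (i + 3) true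

/-- Decrement a register. -/
def dec (i : ℕ) : StackProg := pop (i + 3)

theorem runs_inc (i : ℕ) :
    Runs (inc i) (mem a b c r) (mem a b c (Function.update r i (r i + 1))) 1 := by
  have := Runs.push (i + 3) true (mem a b c r)
  rwa [mem_reg, ← List.replicate_succ, update_mem_reg] at this

theorem runs_dec (i : ℕ) :
    Runs (dec i) (mem a b c r) (mem a b c (Function.update r i (r i - 1))) 1 := by
  have := Runs.pop (i + 3) (mem a b c r)
  rwa [mem_reg, List.tail_replicate, update_mem_reg] at this

/-- Repeat `p` while the register is not zero. -/
def whilePos (i : ℕ) (p : StackProg) : StackProg := loop (i + 3) Option.isSome p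

theorem isSome_head_mem_reg (i : ℕ) :
    (mem a b c r (i + 3)).head?.isSome = decide (r i ≠ 0) := by
  rw [mem_reg]
  cases r i <;> simp [List.replicate_succ]

/-- Set a register to zero. -/
def clear (i : ℕ) : StackProg := whilePos i (dec i)

theorem runs_clear (i : ℕ) :
    Runs (clear i) (mem a b c r) (mem a b c (Function.update r i 0)) (2 * r i + 1) := by
  have := Runs.loop (p := dec i) (k := i + 3) (c := Option.isSome) (T := 1)
    (fun j => mem a b c (Function.update r i (r i - j))) (r i)
    (by simp only [isSome_head_mem_reg]; simp) (fun j hj => ⟨by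
      simp only [isSome_head_mem_reg]; simp; omega,
      (runs_dec a b c (Function.update r i (r i - j)) i).conv (by simp [Nat.sub_sub]) le_rfl⟩)
  simp only [Nat.sub_zero, Function.update_eq_self, Nat.sub_self] at this
  exact this.mono (by omega)

/-- Add the register `i` to the register `j` and set it to zero. -/
def move (i j : ℕ) : StackProg := whilePos i (seq (dec i) (inc j))

theorem runs_move {i j : ℕ} (hij : i ≠ j) :
    Runs (move i j) (mem a b c r)
      (mem a b c (Function.update (Function.update r j (r j + r i)) i 0)) (4 * r i + 1) := by
  have := Runs.loop (p := seq (dec i) (inc j)) (k := i + 3) (c := Option.isSome) (T := 3)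
    (fun l => mem a b c (Function.update (Function.update r j (r j + l)) i (r i - l))) (r i)
    (by simp only [isSome_head_mem_reg]; simp) (fun l hl => ⟨by
      simp only [isSome_head_mem_reg]; simp; omega, by
      refine Runs.conv (.seq (runs_dec _ _ _ _ i) (runs_inc _ _ _ _ j)) ?_ (by omega)
      funext m
      simp only [Function.update_apply]
      split_ifs <;> omega⟩)
  simp only [Nat.sub_zero, Nat.add_zero, Function.update_eq_self, Nat.sub_self] at this
  exact this.mono (by omega)

/-- Subtract the register `i` from the register `j` and set it to zero. -/
def subtract (i j : ℕ) : StackProg := whilePos i (seq (dec i) (dec j))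

theorem runs_subtract {i j : ℕ} (hij : i ≠ j) :
    Runs (subtract i j) (mem a b c r)
      (mem a b c (Function.update (Function.update r j (r j - r i)) i 0)) (4 * r i + 1) := by
  have := Runs.loop (p := seq (dec i) (dec j)) (k := i + 3) (c := Option.isSome) (T := 3)
    (fun l => mem a b c (Function.update (Function.update r j (r j - l)) i (r i - l))) (r i)
    (by simp only [isSome_head_mem_reg]; simp) (fun l hl => ⟨by
      simp only [isSome_head_mem_reg]; simp; omega, by
      refine Runs.conv (.seq (runs_dec _ _ _ _ i) (runs_dec _ _ _ _ j)) ?_ (by omega)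
      funext m
      simp only [Function.update_apply]
      split_ifs <;> omega⟩)
  simp only [Nat.sub_zero, Function.update_eq_self, Nat.sub_self] at this
  exact this.mono (by omega)

/-- Copy the register `i` to the register `j`, with the help of the register `l`. -/
def copy (i j l : ℕ) : StackProg :=
  seq (whilePos i (seq (dec i) (seq (inc j) (inc l)))) (move l i)

/-- Reading a unary register destroys it, so its content is poured into both `j` and `l`, and `l` is
poured back. -/
theorem runs_copy {i j l : ℕ} (hij : i ≠ j) (hil : i ≠ l) (hjl : j ≠ l) (hj : r j = 0)
    (hl : r l = 0) :
    Runs (copy i j l) (mem a b c r) (mem a b c (Function.update r j (r i))) (10 * r i + 3) := by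
  have h1 := Runs.loop (p := seq (dec i) (seq (inc j) (inc l))) (k := i + 3) (c := Option.isSome)
    (T := 5) (fun m => mem a b c
      (Function.update (Function.update (Function.update r j m) l m) i (r i - m))) (r i)
    (by simp only [isSome_head_mem_reg]; simp) (fun m hm => ⟨by
      simp only [isSome_head_mem_reg]; simp; omega, by
      refine Runs.conv (.seq (runs_dec _ _ _ _ i) (.seq (runs_inc _ _ _ _ j)
        (runs_inc _ _ _ _ l))) ?_ (by omega)
      funext m
      simp only [Function.update_apply]
      split_ifs <;> omega⟩)
  have h0 : Function.update (Function.update (Function.update r j 0) l 0) i (r i - 0) = r := by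
    funext m
    simp only [Function.update_apply]
    split_ifs <;> simp_all
  rw [h0] at h1
  have h2 := runs_move a b c (Function.update (Function.update (Function.update r j (r i)) l (r i))
    i (r i - r i)) (Ne.symm hil)
  refine (h1.seq h2).conv ?_ (by
    simp only [Function.update_apply, if_neg (Ne.symm hil), if_true]; omega)
  funext m
  simp only [Function.update_apply]
  split_ifs <;> simp_all

/-- Run `p` with the values `0, 1, …` of the register `i`, as often as the register `n` says; then
set both registers to zero. -/
def forLoop (n i : ℕ) (p : StackProg) : StackProg :=
  seq (whilePos n (seq (dec n) (seq p (inc i)))) (clear i)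

/-- The counter `n` drops before the body and `i` grows after it, so the body of round `j` sees `N -
j - 1` and `j`. The remaining registers and the output evolve along `R` and `out`. -/
theorem runs_forLoop {n i N T : ℕ} {p : StackProg} (hni : n ≠ i) (out : ℕ → List Bool)
    (R : ℕ → ℕ → ℕ)
    (h : ∀ j < N, Runs p (mem a b (out j) (Function.update (Function.update (R j) n (N - j - 1)) i j))
      (mem a b (out (j + 1)) (Function.update (Function.update (R (j + 1)) n (N - j - 1)) i j)) T) :
    Runs (forLoop n i p) (mem a b (out 0) (Function.update (Function.update (R 0) n N) i 0))
      (mem a b (out N) (Function.update (Function.update (R N) n 0) i 0)) (N * (T + 7) + 3) := by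
  have h1 := Runs.loop (p := seq (dec n) (seq p (inc i))) (k := n + 3) (c := Option.isSome)
    (T := T + 4) (fun m => mem a b (out m)
      (Function.update (Function.update (R m) n (N - m)) i m)) N
    (by simp only [isSome_head_mem_reg]; simp [hni]) (fun m hm => ⟨by
      simp only [isSome_head_mem_reg]; simp [hni]; omega, by
      have h2 := (h m hm).seq (runs_inc _ _ _ _ i)
      have h3 := runs_dec a b (out m) (Function.update (Function.update (R m) n (N - m)) i m) n
      have h4 : Function.update (Function.update (Function.update (R m) n (N - m)) i m) n
          (Function.update (Function.update (R m) n (N - m)) i m n - 1) =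
          Function.update (Function.update (R m) n (N - m - 1)) i m := by
        funext l
        simp only [Function.update_apply]
        split_ifs <;> omega
      rw [h4] at h3
      refine (h3.seq h2).conv ?_ (by omega)
      funext l
      simp only [Function.update_apply]
      split_ifs <;> omega⟩)
  have h5 := runs_clear a b (out N) (Function.update (Function.update (R N) n (N - N)) i N) i
  refine (h1.seq h5).conv ?_ (by simp; ring_nf; omega)
  funext l
  simp only [Function.update_apply]
  split_ifs <;> omega

end mem
end StackProg

/-! ### Reading numbers off the input stack. -/

@[simp] theorem bits_nil : bits [] = [] := rfl

@[simp] theorem bits_cons (n : ℕ) (l : List ℕ) :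
    bits (n :: l) = List.replicate n true ++ false :: bits l := by simp [bits]

theorem bits_append (l m : List ℕ) : bits (l ++ m) = bits l ++ bits m := by simp [bits]

/-- The run of leading ones is the first number, and it is empty when the list is. Thus a lookup
past the end returns the default `0` without a special case. -/
theorem exists_bits_eq (l : List ℕ) :
    ∃ a, bits l = List.replicate (l.headD 0) true ++ a ∧ a.head? ≠ some true := by
  cases l with
  | nil => exact ⟨[], by simp⟩
  | cons n l => exact ⟨false :: bits l, by simp⟩

theorem length_bits_drop_le (l : List ℕ) (i : ℕ) : (bits (l.drop i)).length ≤ (bits l).length := by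
  conv_rhs => rw [← List.take_append_drop i l, bits_append]
  simp

theorem headD_le_length_bits (l : List ℕ) : l.headD 0 ≤ (bits l).length := by
  cases l <;> simp

theorem getD_le_length_bits (l : List ℕ) (i : ℕ) : l.getD i 0 ≤ (bits l).length := by
  have h := headD_le_length_bits (l.drop i)
  have h' : (l.drop i).headD 0 = l.getD i 0 := by simp [List.headD_eq_head?_getD, List.head?_drop]
  exact h' ▸ h.trans (length_bits_drop_le l i)

namespace StackProg

variable (a b c : List Bool) (r : ℕ → ℕ)

/-- Move ones from the stack `0` to the stack `1`. -/
def shift : StackProg := loop 0 (fun o => o == some true) (seq (pop 0) (push 1 true))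

variable {a} in
theorem runs_shift (n : ℕ) (ha : a.head? ≠ some true) :
    Runs shift (mem (List.replicate n true ++ a) b c r) (mem a (List.replicate n true ++ b) c r)
      (4 * n + 1) := by
  have := Runs.loop (p := seq (pop 0) (push 1 true)) (k := 0) (c := fun o => o == some true) (T := 3)
    (fun j => mem (List.replicate (n - j) true ++ a) (List.replicate j true ++ b) c r) n
    (by simpa using ha) (fun j hj => ⟨by
      obtain ⟨m, hm⟩ : ∃ m, n - j = m + 1 := ⟨n - j - 1, by omega⟩
      simp [hm, List.replicate_succ], by
      obtain ⟨m, hm⟩ : ∃ m, n - j = m + 1 := ⟨n - j - 1, by omega⟩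
      have hm' : n - (j + 1) = m := by omega
      have := (Runs.pop 0 (mem (List.replicate (n - j) true ++ a) (List.replicate j true ++ b) c r)).seq
        (Runs.push 1 true _)
      simpa [hm, hm', List.replicate_succ] using this⟩)
  simp only [Nat.sub_zero, Nat.sub_self, List.replicate_zero, List.nil_append] at this
  exact this.mono (by omega)

/-- Move one number from the stack `0` to the stack `1`. -/
def shiftNumber : StackProg :=
  seq shift (ite 0 Option.isSome (seq (pop 0) (push 1 false)) (seq (push 1 true) (pop 1)))

/-- An exhausted list has no separator to move; there the program pushes a bit and pops it again,
which replaces an empty instruction. -/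
theorem runs_shiftNumber (l : List ℕ) :
    Runs shiftNumber (mem (bits l) b c r) (mem (bits l.tail) ((bits (l.take 1)).reverse ++ b) c r)
      (4 * (bits l).length + 6) := by
  cases l with
  | nil =>
    refine ((runs_shift b c r (a := []) 0 (by simp)).seq
      (Runs.iteFalse (by simp) ?_)).mono ?_ (T₁ := 1 + 4 + 1)
    rotate_left
    · simp
    · have := (Runs.push 1 true (mem [] b c r)).seq (Runs.pop 1 _)
      simpa using this
  | cons n l =>
    rw [bits_cons]
    refine ((runs_shift b c r (a := false :: bits l) n (by simp)).seq
      (Runs.iteTrue (by simp) ?_)).mono ?_ (T₁ := 4 * n + 1 + 4 + 1)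
    rotate_left
    · simp
    · have := (Runs.pop 0 (mem (false :: bits l) (List.replicate n true ++ b) c r)).seq
        (Runs.push 1 false _)
      simpa using this

/-- Move all of the stack `1` to the stack `0`. -/
def rewind : StackProg :=
  loop 1 Option.isSome
    (ite 1 (fun o => o == some true) (seq (pop 1) (push 0 true)) (seq (pop 1) (push 0 false)))

theorem runs_rewind :
    Runs rewind (mem a b c r) (mem (b.reverse ++ a) [] c r) (5 * b.length + 1) := by
  induction b generalizing a with
  | nil => exact ⟨1, le_rfl, .loopDone (by simp)⟩
  | cons x b ih =>
    have h1 : Runs (ite 1 (fun o => o == some true) (seq (pop 1) (push 0 true))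
        (seq (pop 1) (push 0 false))) (mem a (x :: b) c r) (mem (x :: a) b c r) 4 := by
      cases x with
      | true =>
        refine Runs.iteTrue (by simp) ?_
        simpa using (Runs.pop 1 (mem a (true :: b) c r)).seq (Runs.push 0 true _)
      | false =>
        refine Runs.iteFalse (by simp) ?_
        simpa using (Runs.pop 1 (mem a (false :: b) c r)).seq (Runs.push 0 false _)
    obtain ⟨t, ht, h1⟩ := h1
    obtain ⟨t', ht', h2⟩ := ih (x :: a)
    refine ⟨t + t' + 1, by simp; omega, ?_⟩
    have := Exec.loopStep (k := 1) (c := Option.isSome) (by simp) h1 h2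
    simpa [rewind] using this

/-- Replace the number `i` in the register `w` by the entry `i` of the list of numbers on the
stack `0`. -/
def lookup (w : ℕ) : StackProg :=
  seq (whilePos w (seq (dec w) shiftNumber))
    (seq (loop 0 (fun o => o == some true) (seq (pop 0) (seq (push 1 true) (inc w)))) rewind)

/-- The first `r w` numbers are parked in reverse on the stack `1`. This brings the register to
zero, so the ones of the next number can be counted into it. Rewinding then restores the input. -/
theorem runs_lookup (w : ℕ) (l : List ℕ) :
    Runs (lookup w) (mem (bits l) [] c r) (mem (bits l) [] c (Function.update r w (l.getD (r w) 0)))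
      (r w * (4 * (bits l).length + 9) + 11 * (bits l).length + 20) := by
  have h1 := Runs.loop (p := seq (dec w) shiftNumber) (k := w + 3) (c := Option.isSome)
    (T := 4 * (bits l).length + 8)
    (fun j => mem (bits (l.drop j)) (bits (l.take j)).reverse c (Function.update r w (r w - j))) (r w)
    (by simp only [isSome_head_mem_reg]; simp) (fun j hj => ⟨by
      simp only [isSome_head_mem_reg]; simp; omega, by
      have := length_bits_drop_le l j
      have h2 := ((runs_dec (bits (l.drop j)) (bits (l.take j)).reverse c
        (Function.update r w (r w - j)) w).seq (runs_shiftNumber _ c _ (l.drop j))).mono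
        (T₂ := 4 * (bits l).length + 8) (by omega)
      rw [List.tail_drop, ← List.reverse_append, ← bits_append, ← List.take_add] at h2
      exact h2.conv (by simp [Nat.sub_sub]) le_rfl⟩)
  simp only [List.drop_zero, List.take_zero, bits_nil, List.reverse_nil, Nat.sub_zero,
    Function.update_eq_self, Nat.sub_self] at h1
  obtain ⟨a, ha, ha'⟩ := exists_bits_eq (l.drop (r w))
  have hd : (l.drop (r w)).headD 0 = l.getD (r w) 0 := by
    simp [List.headD_eq_head?_getD, List.head?_drop]
  rw [hd] at ha
  set n := l.getD (r w) 0 with hn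
  have h2 := Runs.loop (p := seq (pop 0) (seq (push 1 true) (inc w))) (k := 0)
    (c := fun o => o == some true) (T := 5)
    (fun j => mem (List.replicate (n - j) true ++ a)
      (List.replicate j true ++ (bits (l.take (r w))).reverse) c (Function.update r w j)) n
    (by simpa using ha') (fun j hj => ⟨by
      obtain ⟨m, hm⟩ : ∃ m, n - j = m + 1 := ⟨n - j - 1, by omega⟩
      simp [hm, List.replicate_succ], by
      obtain ⟨m, hm⟩ : ∃ m, n - j = m + 1 := ⟨n - j - 1, by omega⟩
      have hm' : n - (j + 1) = m := by omega
      have h3 := Runs.pop 0 (mem (List.replicate (n - j) true ++ a)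
        (List.replicate j true ++ (bits (l.take (r w))).reverse) c (Function.update r w j))
      have h4 := Runs.push 1 true (mem (List.replicate m true ++ a)
        (List.replicate j true ++ (bits (l.take (r w))).reverse) c (Function.update r w j))
      have h5 := runs_inc (List.replicate m true ++ a)
        (List.replicate (j + 1) true ++ (bits (l.take (r w))).reverse) c (Function.update r w j) w
      simp only [hm, List.replicate_succ, List.cons_append, mem_zero, List.tail_cons,
        update_mem_zero, mem_one, update_mem_one, Function.update_self, Function.update_idem]
        at h3 h4 h5
      simp only [hm, hm', List.replicate_succ, List.cons_append]
      exact h3.seq (h4.seq h5)⟩)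
  simp only [Nat.sub_zero, Nat.sub_self, List.replicate_zero, List.nil_append, ← ha] at h2
  have h3 := runs_rewind a (List.replicate n true ++ (bits (l.take (r w))).reverse) c
    (Function.update r w n)
  have h4 : (List.replicate n true ++ (bits (l.take (r w))).reverse).reverse ++ a = bits l := by
    conv_rhs => rw [← List.take_append_drop (r w) l, bits_append, ha]
    simp
  have h5 : (List.replicate n true ++ (bits (l.take (r w))).reverse).length ≤ (bits l).length := by
    rw [← h4]; simp; omega
  have h6 : n ≤ (bits l).length := getD_le_length_bits l _
  rw [h4] at h3
  exact (h1.seq (h2.seq h3)).mono (by ring_nf at *; omega)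

end StackProg

open StackProg

/-! ## Functions computed by stack programs in polynomial time -/

/-- The elements of `X` are given by a list of numbers (the input) and an environment that has the
values of finitely many local variables. -/
class Context (X : Type) where
  inp : X → List ℕ
  env : X → ℕ → ℕ

open Context

instance : Context (List ℕ) := ⟨id, fun _ _ => 0⟩

/-- Extend an environment by a value for the variable `0`. -/
def consEnv (a : ℕ) (e : ℕ → ℕ) : ℕ → ℕ
  | 0 => a
  | i + 1 => e i

/-- Local variables are de Bruijn indices: a loop body is a function on `X × ℕ`, and the newest
variable has index `0`. -/
instance {X : Type} [Context X] : Context (X × ℕ) :=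
  ⟨fun p => inp p.1, fun p => consEnv p.2 (env p.1)⟩

section

variable {X : Type} [Context X]

/-- The input has size at most `B`, and so have the values of the variables. -/
def Fits (x : X) (B : ℕ) : Prop := (bits (inp x)).length ≤ B ∧ ∀ j, env x j ≤ B

/-- The variable `j` is in the register `ρ j`, and the registers from `w` on are free. -/
def Ready (x : X) (w : ℕ) (ρ r : ℕ → ℕ) : Prop :=
  (∀ j, ρ j < w ∧ r (ρ j) = env x j) ∧ ∀ i, w ≤ i → r i = 0

theorem Ready.mono {x : X} {w w' : ℕ} {ρ r r' : ℕ → ℕ} (h : Ready x w ρ r) (hw : w ≤ w')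
    (h1 : ∀ i < w, r' i = r i) (h2 : ∀ i, w' ≤ i → r' i = 0) : Ready x w' ρ r' :=
  ⟨fun j => ⟨(h.1 j).1.trans_le hw, (h1 _ (h.1 j).1).trans (h.1 j).2⟩, h2⟩

theorem Ready.update {x : X} {w a : ℕ} {ρ r : ℕ → ℕ} (h : Ready x w ρ r) :
    Ready x (w + 1) ρ (Function.update r w a) :=
  h.mono (Nat.le_succ w) (fun i hi => Function.update_of_ne (by omega) _ _) fun i hi => by
    rw [Function.update_of_ne (by omega), h.2 i (by omega)]

/-- The registers from `w` up to `w' - 1` are unconstrained; a loop keeps its counter and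
accumulator there. -/
theorem Ready.cons {x : X} {w w' : ℕ} {ρ r r' : ℕ → ℕ} (h : Ready x w ρ r) (hw : w ≤ w')
    (h1 : ∀ i < w, r' i = r i) (h2 : ∀ i, w' < i → r' i = 0) :
    Ready (x, r' w') (w' + 1) (consEnv w' ρ) r' := by
  refine ⟨fun j => ?_, fun i hi => h2 i hi⟩
  cases j with
  | zero => exact ⟨Nat.lt_succ_self _, rfl⟩
  | succ j =>
    exact ⟨by have := (h.1 j).1; simp only [consEnv]; omega, (h1 _ (h.1 j).1).trans (h.1 j).2⟩

theorem Fits.cons {x : X} {B C a : ℕ} (h : Fits x B) (ha : a ≤ C) : Fits (x, a) (B + C) := by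
  refine ⟨h.1.trans (Nat.le_add_right B C), fun j => ?_⟩
  cases j with
  | zero => exact ha.trans (Nat.le_add_left C B)
  | succ j => exact (h.2 j).trans (Nat.le_add_right B C)

/-- The function `f` is computed by a stack program in polynomial time. -/
def Comp (f : X → ℕ) : Prop :=
  ∃ (P : ℕ → (ℕ → ℕ) → StackProg) (T : ℕ → ℕ), PolyBounded T ∧
    ∀ x B w ρ r out, Fits x B → Ready x w ρ r → f x ≤ T B ∧
      Runs (P w ρ) (mem (bits (inp x)) [] out r)
        (mem (bits (inp x)) [] out (Function.update r w (f x))) (T B)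

/-- The list of numbers `g x` is written by a stack program in polynomial time. -/
def Emit (g : X → List ℕ) : Prop :=
  ∃ (P : ℕ → (ℕ → ℕ) → StackProg) (T : ℕ → ℕ), PolyBounded T ∧
    ∀ x B w ρ r out, Fits x B → Ready x w ρ r → (bits (g x)).length ≤ T B ∧
      Runs (P w ρ) (mem (bits (inp x)) [] out r)
        (mem (bits (inp x)) [] ((bits (g x)).reverse ++ out) r) (T B)

/-! ### Closure properties of polynomial-time functions. -/

namespace Comp

variable {f g h : X → ℕ}

theorem const (a : ℕ) : Comp fun _ : X => a := by
  induction a with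
  | zero =>
    refine ⟨fun w _ => clear w, fun _ => 1, .const 1, fun x B w ρ r out _ hr => ⟨by simp, ?_⟩⟩
    exact (runs_clear _ _ _ _ w).mono (by simp [hr.2 w le_rfl])
  | succ a ih =>
    obtain ⟨P, T, hT, hP⟩ := ih
    refine ⟨fun w ρ => .seq (P w ρ) (inc w), fun B => T B + 2, hT.add (.const 2),
      fun x B w ρ r out hx hr => ?_⟩
    beta_reduce
    obtain ⟨h1, h2⟩ := hP x B w ρ r out hx hr
    beta_reduce at h1
    exact ⟨by omega, (h2.seq (runs_inc _ _ _ _ w)).conv (by simp) (by omega)⟩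

theorem var (j : ℕ) : Comp fun x : X => env x j := by
  refine ⟨fun w ρ => copy (ρ j) w (w + 1), fun B => 10 * B + 3,
    ((PolyBounded.const 10).mul .id).add (.const 3), fun x B w ρ r out hx hr => ?_⟩
  beta_reduce
  have h1 := hr.1 j
  have h2 := hx.2 j
  refine ⟨by omega, ?_⟩
  have := runs_copy (bits (inp x)) [] out r (i := ρ j) (j := w) (l := w + 1) (by omega) (by omega)
    (by omega) (hr.2 _ le_rfl) (hr.2 _ (by omega))
  rw [h1.2] at this
  exact this.mono (by omega)

theorem snd : Comp fun p : X × ℕ => p.2 := var 0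

/-- Weakening: the same program, with the newest variable dropped from the register map. -/
theorem comp_fst (hf : Comp f) : Comp fun p : X × ℕ => f p.1 := by
  obtain ⟨P, T, hT, hP⟩ := hf
  refine ⟨fun w ρ => P w fun j => ρ (j + 1), T, hT, fun x B w ρ r out hx hr => ?_⟩
  beta_reduce
  exact hP x.1 B w _ r out ⟨hx.1, fun j => hx.2 (j + 1)⟩ ⟨fun j => hr.1 (j + 1), hr.2⟩

theorem getD (hf : Comp f) : Comp fun x => (inp x).getD (f x) 0 := by
  obtain ⟨P, T, hT, hP⟩ := hf
  refine ⟨fun w ρ => .seq (P w ρ) (lookup w), fun B => T B + (T B * (4 * B + 9) + 11 * B + 21),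
    hT.add ((((hT.mul (((PolyBounded.const 4).mul .id).add (.const 9))).add
      ((PolyBounded.const 11).mul .id))).add (.const 21)), fun x B w ρ r out hx hr => ?_⟩
  beta_reduce
  obtain ⟨h1, h2⟩ := hP x B w ρ r out hx hr
  have h3 := getD_le_length_bits (inp x) (f x)
  have h4 := hx.1
  refine ⟨by nlinarith, (h2.seq (runs_lookup _ _ w _)).conv (by simp) ?_⟩
  have h5 : f x * (4 * (bits (inp x)).length + 9) ≤ T B * (4 * B + 9) := by gcongr
  simp only [Function.update_self]
  omega

theorem add (hf : Comp f) (hg : Comp g) : Comp fun x => f x + g x := by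
  obtain ⟨P, S, hS, hP⟩ := hf
  obtain ⟨Q, T, hT, hQ⟩ := hg
  refine ⟨fun w ρ => .seq (P w ρ) (.seq (Q (w + 1) ρ) (move (w + 1) w)),
    fun B => S B + 5 * T B + 3, (hS.add ((PolyBounded.const 5).mul hT)).add (.const 3),
    fun x B w ρ r out hx hr => ?_⟩
  beta_reduce
  obtain ⟨h1, h2⟩ := hP x B w ρ r out hx hr
  obtain ⟨h3, h4⟩ := hQ x B (w + 1) ρ _ out hx (hr.update (a := f x))
  refine ⟨by omega, (h2.seq (h4.seq (runs_move _ _ _ _ (by omega)))).conv ?_ (by simp; omega)⟩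
  funext i
  have := hr.2 (w + 1) (by omega)
  by_cases hi : i = w + 1
  · subst hi; simp [this]
  · by_cases hi' : i = w
    · subst hi'; simp
    · simp [hi, hi']

theorem sub (hf : Comp f) (hg : Comp g) : Comp fun x => f x - g x := by
  obtain ⟨P, S, hS, hP⟩ := hf
  obtain ⟨Q, T, hT, hQ⟩ := hg
  refine ⟨fun w ρ => .seq (P w ρ) (.seq (Q (w + 1) ρ) (subtract (w + 1) w)),
    fun B => S B + 5 * T B + 3, (hS.add ((PolyBounded.const 5).mul hT)).add (.const 3),
    fun x B w ρ r out hx hr => ?_⟩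
  beta_reduce
  obtain ⟨h1, h2⟩ := hP x B w ρ r out hx hr
  obtain ⟨h3, h4⟩ := hQ x B (w + 1) ρ _ out hx (hr.update (a := f x))
  refine ⟨by omega, (h2.seq (h4.seq (runs_subtract _ _ _ _ (by omega)))).conv ?_ (by simp; omega)⟩
  funext i
  have := hr.2 (w + 1) (by omega)
  by_cases hi : i = w + 1
  · subst hi; simp [this]
  · by_cases hi' : i = w
    · subst hi'; simp
    · simp [hi, hi']

/-- Both branches expect `w` to be free. A test value zero leaves it free; a nonzero one has to be
cleared first. -/
theorem ite (hf : Comp f) (hg : Comp g) (hh : Comp h) :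
    Comp fun x => if f x = 0 then g x else h x := by
  obtain ⟨P, S, hS, hP⟩ := hf
  obtain ⟨Q, T, hT, hQ⟩ := hg
  obtain ⟨R, U, hU, hR⟩ := hh
  refine ⟨fun w ρ => .seq (P w ρ) (.ite (w + 3) Option.isSome (.seq (clear w) (R w ρ)) (Q w ρ)),
    fun B => 3 * S B + (T B + U B) + 4,
    (((PolyBounded.const 3).mul hS).add (hT.add hU)).add (.const 4),
    fun x B w ρ r out hx hr => ?_⟩
  beta_reduce
  obtain ⟨h1, h2⟩ := hP x B w ρ r out hx hr
  obtain ⟨h3, h4⟩ := hQ x B w ρ r out hx hr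
  obtain ⟨h5, h6⟩ := hR x B w ρ r out hx hr
  have hw := hr.2 w le_rfl
  by_cases hf : f x = 0
  · have e : Function.update r w (f x) = r := by rw [hf, ← hw, Function.update_eq_self]
    simp only [hf, if_true]
    refine ⟨by omega, (h2.seq (.iteFalse (T := T B) ?_ ?_)).mono (by omega)⟩
    · simp only [isSome_head_mem_reg]; simp [hf]
    · rwa [e]
  · simp only [hf, if_false]
    refine ⟨by omega, (h2.seq (.iteTrue (T := 2 * f x + 1 + U B + 1) ?_
      (.seq ((runs_clear _ _ _ _ w).conv (r' := r) ?_ ?_) h6))).mono (by omega)⟩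
    · simp only [isSome_head_mem_reg]; simp [hf]
    · rw [Function.update_idem, ← hw, Function.update_eq_self]
    · simp

/-- Register `w` accumulates, `w + 1` counts down, `w + 2` is the loop variable and `w + 3` receives
the summand. The loop variable is below `f x ≤ S B`, so the body works in a context of size `B + S
B`. -/
theorem sum {f : X → ℕ} {g : X → ℕ → ℕ} (hf : Comp f) (hg : Comp fun p : X × ℕ => g p.1 p.2) :
    Comp fun x => ∑ i ∈ Finset.range (f x), g x i := by
  obtain ⟨P, S, hS, hP⟩ := hf
  obtain ⟨Q, T, hT, hQ⟩ := hg
  have hT' := hT.comp (PolyBounded.id.add hS)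
  refine ⟨fun w ρ => .seq (P (w + 1) ρ) (forLoop (w + 1) (w + 2)
      (.seq (Q (w + 3) (consEnv (w + 2) ρ)) (move (w + 3) w))),
    fun B => S B + (S B * (5 * T (B + S B) + 9) + 4),
    hS.add ((hS.mul (((PolyBounded.const 5).mul hT').add (.const 9))).add (.const 4)),
    fun x B w ρ r out hx hr => ?_⟩
  beta_reduce
  have hr1 : Ready x (w + 1) ρ r :=
    hr.mono (Nat.le_succ w) (fun _ _ => rfl) fun i hi => hr.2 i (by omega)
  obtain ⟨h1, h2⟩ := hP x B (w + 1) ρ r out hx hr1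
  have hb : ∀ i < f x, g x i ≤ T (B + S B) := fun i hi =>
    (hQ (x, i) (B + S B) (w + 2 + 1) (consEnv (w + 2) ρ) (Function.update r (w + 2) i) out
      (hx.cons (by omega)) (by
        have := hr.cons (w' := w + 2) (r' := Function.update r (w + 2) i) (by omega)
          (fun j hj => Function.update_of_ne (by omega) _ _)
          (fun j hj => by rw [Function.update_of_ne (by omega), hr.2 j (by omega)])
        rwa [Function.update_self] at this)).1
  have h3 := runs_forLoop (bits (inp x)) [] (n := w + 1) (i := w + 2) (N := f x)
    (T := 5 * T (B + S B) + 2) (by omega)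
    (p := .seq (Q (w + 3) (consEnv (w + 2) ρ)) (move (w + 3) w)) (fun _ => out)
    (fun j => Function.update r w (∑ i ∈ Finset.range j, g x i)) (fun j hj => by
      set R := Function.update (Function.update (Function.update r w (∑ i ∈ Finset.range j, g x i))
        (w + 1) (f x - j - 1)) (w + 2) j with hR
      have h4 : Ready (x, R (w + 2)) (w + 2 + 1) (consEnv (w + 2) ρ) R := by
        refine hr.cons (by omega) (fun i hi => ?_) fun i hi => ?_
        · simp only [hR, Function.update_apply]
          split_ifs <;> omega
        · have := hr.2 i (by omega)
          simp only [hR, Function.update_apply]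
          split_ifs <;> omega
      have h5 : R (w + 2) = j := by simp [hR]
      rw [h5] at h4
      obtain ⟨h6, h7⟩ := hQ (x, j) (B + S B) (w + 3) (consEnv (w + 2) ρ) R out
        (hx.cons (by omega)) h4
      refine (h7.seq (runs_move _ _ _ _ (by omega))).conv ?_ (by simp at h6 ⊢; omega)
      funext i
      have := hr.2 (w + 3) (by omega)
      simp only [hR, Finset.sum_range_succ, Function.update_apply]
      split_ifs <;> first | omega | simp_all)
  have h8 : ∑ i ∈ Finset.range (f x), g x i ≤ S B * T (B + S B) := by
    refine (Finset.sum_le_card_nsmul _ _ (T (B + S B)) fun i hi => hb i (Finset.mem_range.1 hi)).trans ?_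
    simp only [Finset.card_range, smul_eq_mul]
    gcongr
  have h9 : f x * (5 * T (B + S B) + 9) ≤ S B * (5 * T (B + S B) + 9) := by gcongr
  refine ⟨by nlinarith, ?_⟩
  have h10 : Function.update (Function.update (Function.update r w
      (∑ i ∈ Finset.range 0, g x i)) (w + 1) (f x)) (w + 2) 0 = Function.update r (w + 1) (f x) := by
    have := hr.2 w le_rfl
    have := hr.2 (w + 2) (by omega)
    funext i
    simp only [Function.update_apply, Finset.sum_range_zero]
    split_ifs <;> simp_all
  rw [h10] at h3
  refine (h2.seq h3).conv ?_ (by ring_nf at *; omega)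
  have := hr.2 (w + 1) (by omega)
  have := hr.2 (w + 2) (by omega)
  funext i
  simp only [Function.update_apply]
  split_ifs <;> first | omega | simp_all

theorem mul (hf : Comp f) (hg : Comp g) : Comp fun x => f x * g x := by
  simpa using hf.sum (g := fun x _ => g x) hg.comp_fst

end Comp

/-! ### Closure properties of polynomial-time output. -/

namespace Emit

/-- Clearing a register that is already zero acts as the empty program. -/
theorem nil : Emit fun _ : X => [] :=
  ⟨fun w _ => clear w, fun _ => 1, .const 1, fun x B w ρ r out _ hr => ⟨by simp, by
    have h := hr.2 w le_rfl
    exact (runs_clear _ _ _ _ w).conv (by rw [← h, Function.update_eq_self]) (by simp [h])⟩⟩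

theorem append {g h : X → List ℕ} (hg : Emit g) (hh : Emit h) : Emit fun x => g x ++ h x := by
  obtain ⟨P, S, hS, hP⟩ := hg
  obtain ⟨Q, T, hT, hQ⟩ := hh
  refine ⟨fun w ρ => .seq (P w ρ) (Q w ρ), fun B => S B + T B + 1, (hS.add hT).add (.const 1),
    fun x B w ρ r out hx hr => ?_⟩
  beta_reduce
  obtain ⟨h1, h2⟩ := hP x B w ρ r out hx hr
  obtain ⟨h3, h4⟩ := hQ x B w ρ r _ hx hr
  refine ⟨by simp [bits_append]; omega, ?_⟩
  simpa [bits_append] using h2.seq h4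

theorem singleton {f : X → ℕ} (hf : Comp f) : Emit fun x => [f x] := by
  obtain ⟨P, S, hS, hP⟩ := hf
  refine ⟨fun w ρ => .seq (P w ρ) (.seq (whilePos w (.seq (dec w) (push 2 true))) (push 2 false)),
    fun B => 5 * S B + 4, ((PolyBounded.const 5).mul hS).add (.const 4),
    fun x B w ρ r out hx hr => ?_⟩
  beta_reduce
  obtain ⟨h1, h2⟩ := hP x B w ρ r out hx hr
  have h3 := Runs.loop (p := .seq (dec w) (push 2 true)) (k := w + 3) (c := Option.isSome) (T := 3)
    (fun j => mem (bits (inp x)) [] (List.replicate j true ++ out) (Function.update r w (f x - j)))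
    (f x) (by simp only [isSome_head_mem_reg]; simp) (fun j hj => ⟨by
      simp only [isSome_head_mem_reg]; simp; omega, by
      have := (runs_dec (bits (inp x)) [] (List.replicate j true ++ out)
        (Function.update r w (f x - j)) w).seq (Runs.push 2 true _)
      simpa [List.replicate_succ, Nat.sub_sub] using this⟩)
  have h4 : Function.update r w (f x - f x) = r := by
    rw [Nat.sub_self, ← hr.2 w le_rfl, Function.update_eq_self]
  rw [h4] at h3
  have h5 := h2.seq (h3.seq (Runs.push 2 false _))
  simp only [mem_two, update_mem_two] at h5
  refine ⟨by simp; omega, ?_⟩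
  simpa [whilePos] using h5.mono (T₂ := 5 * S B + 4) (by omega)

theorem ite {f : X → ℕ} {g h : X → List ℕ} (hf : Comp f) (hg : Emit g) (hh : Emit h) :
    Emit fun x => if f x = 0 then g x else h x := by
  obtain ⟨P, S, hS, hP⟩ := hf
  obtain ⟨Q, T, hT, hQ⟩ := hg
  obtain ⟨R, U, hU, hR⟩ := hh
  refine ⟨fun w ρ => .seq (P w ρ) (.ite (w + 3) Option.isSome (.seq (clear w) (R w ρ)) (Q w ρ)),
    fun B => 3 * S B + (T B + U B) + 4,
    (((PolyBounded.const 3).mul hS).add (hT.add hU)).add (.const 4),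
    fun x B w ρ r out hx hr => ?_⟩
  beta_reduce
  obtain ⟨h1, h2⟩ := hP x B w ρ r out hx hr
  obtain ⟨h3, h4⟩ := hQ x B w ρ r out hx hr
  obtain ⟨h5, h6⟩ := hR x B w ρ r out hx hr
  have hw := hr.2 w le_rfl
  by_cases hf : f x = 0
  · have e : Function.update r w (f x) = r := by rw [hf, ← hw, Function.update_eq_self]
    simp only [hf, if_true]
    refine ⟨by omega, (h2.seq (.iteFalse (T := T B) ?_ ?_)).mono (by omega)⟩
    · simp only [isSome_head_mem_reg]; simp [hf]
    · rwa [e]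
  · simp only [hf, if_false]
    refine ⟨by omega, (h2.seq (.iteTrue (T := 2 * f x + 1 + U B + 1) ?_
      (.seq ((runs_clear _ _ _ _ w).conv (r' := r) ?_ ?_) h6))).mono (by omega)⟩
    · simp only [isSome_head_mem_reg]; simp [hf]
    · rw [Function.update_idem, ← hw, Function.update_eq_self]
    · simp

theorem flatMap {f : X → ℕ} {g : X → ℕ → List ℕ} (hf : Comp f)
    (hg : Emit fun p : X × ℕ => g p.1 p.2) :
    Emit fun x => (List.range (f x)).flatMap fun i => g x i := by
  obtain ⟨P, S, hS, hP⟩ := hf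
  obtain ⟨Q, T, hT, hQ⟩ := hg
  have hT' := hT.comp (PolyBounded.id.add hS)
  refine ⟨fun w ρ => .seq (P w ρ) (forLoop w (w + 1) (Q (w + 2) (consEnv (w + 1) ρ))),
    fun B => S B + (S B * (T (B + S B) + 7) + 4),
    hS.add ((hS.mul (hT'.add (.const 7))).add (.const 4)),
    fun x B w ρ r out hx hr => ?_⟩
  beta_reduce
  obtain ⟨h1, h2⟩ := hP x B w ρ r out hx hr
  -- The output stack holds the code in reverse, so each round puts its block in front.
  set out' : ℕ → List Bool := fun j =>
    (bits ((List.range j).flatMap fun i => g x i)).reverse ++ out with hout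
  have hb : ∀ j < f x, (bits (g x j)).length ≤ T (B + S B) ∧
      Runs (Q (w + 2) (consEnv (w + 1) ρ))
        (mem (bits (inp x)) [] (out' j) (Function.update (Function.update r w (f x - j - 1)) (w + 1) j))
        (mem (bits (inp x)) [] (out' (j + 1))
          (Function.update (Function.update r w (f x - j - 1)) (w + 1) j)) (T (B + S B)) := by
    intro j hj
    set R := Function.update (Function.update r w (f x - j - 1)) (w + 1) j with hR
    have h4 : Ready (x, R (w + 1)) (w + 1 + 1) (consEnv (w + 1) ρ) R := by
      refine hr.cons (by omega) (fun i hi => ?_) fun i hi => ?_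
      · simp only [hR, Function.update_apply]
        split_ifs <;> omega
      · have := hr.2 i (by omega)
        simp only [hR, Function.update_apply]
        split_ifs <;> omega
    have h5 : R (w + 1) = j := by simp [hR]
    rw [h5] at h4
    have h6 := hQ (x, j) (B + S B) (w + 2) (consEnv (w + 1) ρ) R (out' j) (hx.cons (by omega)) h4
    refine ⟨h6.1, ?_⟩
    have h7 : out' (j + 1) = (bits (g x j)).reverse ++ out' j := by
      simp [hout, List.range_succ, List.flatMap_append, bits_append]
    rw [h7]
    exact h6.2
  have h3 := runs_forLoop (bits (inp x)) [] (n := w) (i := w + 1) (N := f x) (T := T (B + S B))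
    (by omega) (p := Q (w + 2) (consEnv (w + 1) ρ)) out' (fun _ => r) fun j hj => (hb j hj).2
  have h8 : ∀ j ≤ f x, (bits ((List.range j).flatMap fun i => g x i)).length ≤ j * T (B + S B) := by
    intro j hj
    induction j with
    | zero => simp
    | succ j ih =>
      have := ih (by omega)
      have := (hb j (by omega)).1
      rw [List.range_succ, List.flatMap_append, bits_append, List.length_append, Nat.succ_mul]
      simpa using by omega
  have h9 : f x * (T (B + S B) + 7) ≤ S B * (T (B + S B) + 7) := by gcongr
  have h10 := h8 (f x) le_rfl
  refine ⟨by nlinarith, ?_⟩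
  have hw := hr.2 w le_rfl
  have hw' := hr.2 (w + 1) (by omega)
  have h11 : Function.update (Function.update r w (f x)) (w + 1) 0 = Function.update r w (f x) := by
    funext i
    simp only [Function.update_apply]
    split_ifs <;> simp_all
  rw [h11] at h3
  refine (h2.seq h3).conv ?_ (by ring_nf at *; omega)
  funext i
  simp only [Function.update_apply]
  split_ifs <;> simp_all

end Emit
end

/-- A list of numbers that can be written in polynomial time is the output of a polynomial-time
Turing machine. -/
theorem Emit.exists_machine {g : List ℕ → List ℕ} (hg : Emit g) :
    ∃ M : Turing.TM2ComputableAux Bool Bool, (∀ i, Finite (M.tm.Γ i)) ∧ ∃ c : ℕ,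
      ∀ l, 2 ≤ (bits l).length →
        OutputsWithin M (bits l) (bits (g l)) ((bits l).length ^ c) := by
  obtain ⟨P, T, hT, hP⟩ := hg
  obtain ⟨M, hM, hM'⟩ := StackProg.exists_machine
    -- After the output is written, the input is erased and the stack `2` is poured onto the stack
    -- `1`, which undoes the reversal and leaves nothing else.
    (.seq (P 1 fun _ => 0) (.seq (.loop 0 Option.isSome (pop 0))
      (.loop 2 Option.isSome (.ite 2 (fun o => o == some true)
        (.seq (pop 2) (push 1 true)) (.seq (pop 2) (push 1 false))))))
  obtain ⟨c, hc⟩ : PolyBounded fun B => T B + (2 * B + (5 * T B + 5)) :=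
    hT.add (((PolyBounded.const 2).mul .id).add (((PolyBounded.const 5).mul hT).add (.const 5)))
  -- The exponent doubles because `n + 2 ≤ n ^ 2` for `n ≥ 2`.
  refine ⟨M, hM, 2 * c, fun l hl => ?_⟩
  obtain ⟨h1, h2⟩ := hP l (bits l).length 1 (fun _ => 0) (fun _ => 0) []
    ⟨le_rfl, fun _ => Nat.zero_le _⟩ ⟨fun _ => ⟨Nat.one_pos, rfl⟩, fun _ _ => rfl⟩
  have h3 : ∀ a c r, Runs (.loop 0 Option.isSome (pop 0)) (mem a [] c r) (mem [] [] c r)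
      (2 * a.length + 1) := by
    intro a c r
    induction a with
    | nil => exact ⟨1, by simp, .loopDone (by simp)⟩
    | cons x a ih =>
      obtain ⟨t, ht, h⟩ := ih
      refine ⟨1 + t + 1, by simp; omega, .loopStep (by simp) (.pop _ _) ?_⟩
      simpa using h
  have h4 : ∀ b c r, Runs (.loop 2 Option.isSome (.ite 2 (fun o => o == some true)
        (.seq (pop 2) (push 1 true)) (.seq (pop 2) (push 1 false)))) (mem [] b c r)
        (mem [] (c.reverse ++ b) [] r) (5 * c.length + 1) := by
    intro b c r
    induction c generalizing b with
    | nil => exact ⟨1, by simp, .loopDone (by simp)⟩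
    | cons x c ih =>
      obtain ⟨t, ht, h⟩ := ih (x :: b)
      refine ⟨4 + t + 1, by simp; omega, .loopStep (s₁ := mem [] (x :: b) c r) (by simp) ?_ ?_⟩
      · cases x with
        | true =>
          refine .iteTrue (by simp) ?_
          simpa using (Exec.pop 2 (mem [] b (true :: c) r)).seq (.push 1 true _)
        | false =>
          refine .iteFalse (by simp) ?_
          simpa using (Exec.pop 2 (mem [] b (false :: c) r)).seq (.push 1 false _)
      · simpa using h
  have e : ∀ a b, mem a b [] (fun _ => 0) =
      Function.update (Function.update (fun _ => []) 0 a) 1 b := by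
    intro a b
    funext k
    match k with
    | 0 | 1 | 2 | i + 3 => simp [mem, Function.update]
  obtain ⟨t, ht, h⟩ := h2.seq ((h3 _ _ _).seq (h4 _ _ _))
  refine hM' _ _ t _ (by
    have e1 := e (bits l) []
    have e2 := e [] (bits (g l))
    simp only [List.append_nil, List.reverse_reverse] at h
    change Exec _ (mem (bits l) [] [] fun _ => 0) _ t at h
    rw [e1, e2] at h
    convert h using 1
    · funext k; by_cases hk : k = 1 <;> simp [Function.update_apply, hk]
    · simp) ?_
  have h6 := hc (bits l).length
  have h7 : ((bits l).length + 2) ^ c ≤ (bits l).length ^ (2 * c) := by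
    rw [pow_mul]
    exact Nat.pow_le_pow_left (by nlinarith) c
  simp only [List.append_nil, List.length_reverse] at ht
  change t ≤ T (bits l).length + (2 * (bits l).length + 1 + (5 * (bits (g l)).length + 1) + 1) + 1
    at ht
  simp only at h6
  omega

open Context

/-! ## Decidable conditions and lists of clauses -/

section

variable {X : Type} [Context X]

open Classical in
/-- The condition `p` can be decided in polynomial time. -/
def Decides (p : X → Prop) : Prop := Comp fun x => if p x then 1 else 0

namespace Decides

variable {p q : X → Prop} {f g : X → ℕ}

/-- Arithmetic serves as logic: truncated subtraction gives comparison and negation, products give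
conjunction, sums give disjunction and bounded existence. -/
theorem congr (hf : Comp f) (h : ∀ x, f x = 0 ↔ ¬ p x) : Decides p := by
  have := Comp.ite hf (.const 0) (.const 1)
  unfold Decides
  convert this using 2 with x
  by_cases hp : p x
  · simp [hp, (h x).not_left.2 hp]
  · simp [hp, (h x).2 hp]

theorem lt (hf : Comp f) (hg : Comp g) : Decides fun x => f x < g x :=
  congr (hg.sub hf) fun x => by omega

theorem eq (hf : Comp f) (hg : Comp g) : Decides fun x => f x = g x :=
  congr ((Comp.const 1).sub ((hf.sub hg).add (hg.sub hf))) fun x => by omega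

theorem not (hp : Decides p) : Decides fun x => ¬ p x :=
  congr ((Comp.const 1).sub hp) fun x => by by_cases h : p x <;> simp [h]

theorem and (hp : Decides p) (hq : Decides q) : Decides fun x => p x ∧ q x :=
  congr (hp.mul hq) fun x => by by_cases h : p x <;> simp [h]

theorem or (hp : Decides p) (hq : Decides q) : Decides fun x => p x ∨ q x :=
  congr (hp.add hq) fun x => by by_cases h : p x <;> simp [h]

open Classical in
theorem bex {p : X → ℕ → Prop} (hf : Comp f) (hp : Decides fun y : X × ℕ => p y.1 y.2) :
    Decides fun x => ∃ i < f x, p x i :=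
  congr (hf.sum (g := fun x i => if p x i then 1 else 0) hp) fun x => by simp

end Decides

/-- The code of a clause that consists of the negations of the given variables. -/
def codeClause (C : List ℕ) : List ℕ := C.length :: C.flatMap fun v => [v, 0]

/-- The clauses `F x` can be counted and written in polynomial time. -/
def EmitClauses (F : X → List (List ℕ)) : Prop :=
  Comp (fun x => (F x).length) ∧ Emit fun x => (F x).flatMap codeClause

namespace EmitClauses

variable {F G : X → List (List ℕ)}

theorem append (hF : EmitClauses F) (hG : EmitClauses G) : EmitClauses fun x => F x ++ G x :=
  ⟨by simpa using hF.1.add hG.1, by simpa using hF.2.append hG.2⟩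

/-- The code of a formula starts with its number of clauses, so counting accompanies writing; here
the count is a bounded sum. -/
theorem flatMap {f : X → ℕ} {F : X → ℕ → List (List ℕ)} (hf : Comp f)
    (hF : EmitClauses fun y : X × ℕ => F y.1 y.2) :
    EmitClauses fun x => (List.range (f x)).flatMap fun i => F x i := by
  refine ⟨?_, by
    simpa [List.flatMap_assoc] using
      Emit.flatMap hf (g := fun x i => (F x i).flatMap codeClause) hF.2⟩
  have := hf.sum (g := fun x i => (F x i).length) hF.1
  simpa [Finset.sum, List.length_flatMap, Finset.range_val, Multiset.range] using this

theorem ite {p : X → Prop} {inst : ∀ x, Decidable (p x)} (hp : Decides p) (hF : EmitClauses F) :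
    EmitClauses fun x => if p x then F x else [] := by
  refine ⟨?_, ?_⟩
  · convert hp.ite (.const 0) hF.1 using 2 with x
    by_cases h : p x <;> simp [h]
  · convert Emit.ite hp .nil hF.2 using 2 with x
    by_cases h : p x <;> simp [h]

theorem clause {f : X → List ℕ} (n : ℕ) (hn : ∀ x, (f x).length = n)
    (hf : Emit fun x => (f x).flatMap fun v => [v, 0]) : EmitClauses fun x => [f x] :=
  ⟨.const 1, by
    have := (Emit.singleton (.const n)).append hf
    simpa [codeClause, hn] using this⟩

theorem literal {f : X → ℕ} (hf : Comp f) : Emit fun x => [f x, 0] :=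
  (Emit.singleton hf).append (.singleton (.const 0))

variable {f₁ f₂ f₃ f₄ : X → ℕ}

theorem clause₁ (h₁ : Comp f₁) : EmitClauses fun x => [[f₁ x]] :=
  clause 1 (fun _ => rfl) (literal h₁)

theorem clause₂ (h₁ : Comp f₁) (h₂ : Comp f₂) : EmitClauses fun x => [[f₁ x, f₂ x]] :=
  clause 2 (fun _ => rfl) ((literal h₁).append (literal h₂))

theorem clause₃ (h₁ : Comp f₁) (h₂ : Comp f₂) (h₃ : Comp f₃) :
    EmitClauses fun x => [[f₁ x, f₂ x, f₃ x]] :=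
  clause 3 (fun _ => rfl) ((literal h₁).append ((literal h₂).append (literal h₃)))

theorem clause₄ (h₁ : Comp f₁) (h₂ : Comp f₂) (h₃ : Comp f₃) (h₄ : Comp f₄) :
    EmitClauses fun x => [[f₁ x, f₂ x, f₃ x, f₄ x]] :=
  clause 4 (fun _ => rfl)
    ((literal h₁).append ((literal h₂).append ((literal h₃).append (literal h₄))))

end EmitClauses
end

/-! ## The clauses for a planning instance

The planning instance is given by the list `L` of the numbers in its code. A propositional variable
stands for the statement that one of `numSlots L` slots has one of `numValues L` values. -/

/-- The number of variables of the planning instance. -/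
def numVars (L : List ℕ) : ℕ := L.getD 0 0

/-- The size of the domain. -/
def numDom (L : List ℕ) : ℕ := L.getD 1 0

/-- The number of actions. -/
def numActs (L : List ℕ) : ℕ := L.getD 2 0

/-- The bound on the length of the plan. -/
def bound (L : List ℕ) : ℕ := L.getD 3 0

/-- The value of the variable `v` in a partial state: the row `0` is the initial state, the row `1`
is the goal, and the rows `2 + 2 * a` and `3 + 2 * a` are the precondition and the effect of `a`. -/
def entry (L : List ℕ) (row v : ℕ) : ℕ := L.getD (4 + (row * numVars L + v)) 0

/-- The number of possible values of a slot. -/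
def numValues (L : List ℕ) : ℕ := numVars L + numDom L + numActs L + 2

/-- The number of slots. -/
def numSlots (L : List ℕ) : ℕ := (bound L + 3) * (bound L + 2)

/-- The propositional variable for the value `a` of the slot `(p, q)`. -/
def slotVar (L : List ℕ) (p q a : ℕ) : ℕ := (p * (bound L + 2) + q) * numValues L + a

/-- The propositional variable for the action `a` at time `t`; the values from `numActs L` on mean
that there is no action. -/
def actVar (L : List ℕ) (t a : ℕ) : ℕ := slotVar L 0 t a

/-- The propositional variable for tracking the variable `y - 1` in the position `l`; nothing is
tracked if `y = 0` or `numVars L < y`. -/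
def trackVar (L : List ℕ) (l y : ℕ) : ℕ := slotVar L 1 l y

/-- The propositional variable for the code `e` of the value at time `t` of the variable that is
tracked in the position `l`. -/
def valueVar (L : List ℕ) (t l e : ℕ) : ℕ := slotVar L (2 + t) l e

/-- Some variable strictly between the tracked ones has to be changed to reach the goal. -/
def GoalGap (L : List ℕ) (y z : ℕ) : Prop :=
  ∃ x < numVars L, (y < x + 1 ∧ x + 1 < z) ∧ ¬ entry L 1 x = 0 ∧ ¬ entry L 1 x = entry L 0 x

/-- Some variable strictly between the tracked ones is changed by the action `a` or has to be changed
before `a` is valid. -/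
def ActGap (L : List ℕ) (a y z : ℕ) : Prop :=
  ∃ x < numVars L, (y < x + 1 ∧ x + 1 < z) ∧ (¬ entry L (3 + 2 * a) x = 0 ∨
    ¬ entry L (2 + 2 * a) x = 0 ∧ ¬ entry L (2 + 2 * a) x = entry L 0 x)

/-- Concatenation of lists over the numbers below `n`. -/
abbrev listFor {α : Type} (n : ℕ) (f : ℕ → List α) : List α := (List.range n).flatMap f

open Classical

/-- No slot has two values. -/
noncomputable def uniqueClauses (L : List ℕ) : List (List ℕ) :=
  listFor (numSlots L) fun g => listFor (numValues L) fun a => listFor (numValues L) fun b =>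
    if a < b then [[g * numValues L + a, g * numValues L + b]] else []

/-- The first tracked value is `0` and the last one is `numVars L + 1`. -/
noncomputable def endClauses (L : List ℕ) : List (List ℕ) :=
  (listFor (numValues L) fun y => if ¬ y = 0 then [[trackVar L 0 y]] else []) ++
  (listFor (numValues L) fun y =>
    if ¬ y = numVars L + 1 then [[trackVar L (bound L + 1) y]] else [])

/-- The variables in a gap are meant to stay constant, so whether the goal tolerates this can be
read off the input. -/
noncomputable def goalGapClauses (L : List ℕ) : List (List ℕ) :=
  listFor (bound L + 1) fun l => listFor (numValues L) fun y => listFor (numValues L) fun z =>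
    if GoalGap L y z then [[trackVar L l y, trackVar L (l + 1) z]] else []

/-- Preconditions on a gap are compared with the initial state at every time `t`, because the gap is
never changed. -/
noncomputable def actGapClauses (L : List ℕ) : List (List ℕ) :=
  listFor (bound L) fun t => listFor (numActs L) fun a =>
    listFor (bound L + 1) fun l => listFor (numValues L) fun y => listFor (numValues L) fun z =>
      if ActGap L a y z then [[actVar L t a, trackVar L l y, trackVar L (l + 1) z]] else []

/-- The tracked variables have the right value in the initial state and in the goal state. -/
noncomputable def initGoalClauses (L : List ℕ) : List (List ℕ) :=
  listFor (bound L + 2) fun l => listFor (numVars L) fun v => listFor (numValues L) fun e =>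
    (if ¬ entry L 0 v = e then [[trackVar L l (v + 1), valueVar L 0 l e]] else []) ++
    (if ¬ entry L 1 v = 0 ∧ ¬ entry L 1 v = e then
      [[trackVar L l (v + 1), valueVar L (bound L) l e]] else [])

/-- The tracked variables have the values that are required by the precondition and the effect of an
action. -/
noncomputable def preEffClauses (L : List ℕ) : List (List ℕ) :=
  listFor (bound L) fun t => listFor (numActs L) fun a =>
    listFor (bound L + 2) fun l => listFor (numVars L) fun v => listFor (numValues L) fun e =>
      (if ¬ entry L (2 + 2 * a) v = 0 ∧ ¬ entry L (2 + 2 * a) v = e then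
        [[actVar L t a, trackVar L l (v + 1), valueVar L t l e]] else []) ++
      (if ¬ entry L (3 + 2 * a) v = 0 ∧ ¬ entry L (3 + 2 * a) v = e then
        [[actVar L t a, trackVar L l (v + 1), valueVar L (t + 1) l e]] else [])

/-- A tracked variable keeps its value if there is no effect on it. -/
noncomputable def frameClauses (L : List ℕ) : List (List ℕ) :=
  listFor (bound L) fun t => listFor (numValues L) fun a =>
    listFor (bound L + 2) fun l => listFor (numVars L) fun v =>
      listFor (numValues L) fun e => listFor (numValues L) fun e' =>
        if (¬ a < numActs L ∨ entry L (3 + 2 * a) v = 0) ∧ ¬ e = e' then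
          [[actVar L t a, trackVar L l (v + 1), valueVar L t l e, valueVar L (t + 1) l e']] else []

/-- The clauses that express the planning problem. -/
noncomputable def planClauses (L : List ℕ) : List (List ℕ) :=
  endClauses L ++ goalGapClauses L ++ actGapClauses L ++ initGoalClauses L ++ preEffClauses L ++
    frameClauses L

/-- The code of the weighted satisfiability instance. -/
noncomputable def outputCode (L : List ℕ) : List ℕ :=
  numSlots L * numValues L :: numSlots L :: (uniqueClauses L ++ planClauses L).length ::
    (uniqueClauses L ++ planClauses L).flatMap codeClause

/-! ### The clauses can be written in polynomial time. -/

section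

variable {X : Type} [Context X] {l : X → List ℕ} {f g h : X → ℕ}

theorem Comp.numVars (hl : ∀ x, l x = inp x) : Comp fun x => numVars (l x) := by
  simp only [hl]
  exact (Comp.const 0).getD

theorem Comp.numDom (hl : ∀ x, l x = inp x) : Comp fun x => numDom (l x) := by
  simp only [hl]
  exact (Comp.const 1).getD

theorem Comp.numActs (hl : ∀ x, l x = inp x) : Comp fun x => numActs (l x) := by
  simp only [hl]
  exact (Comp.const 2).getD

theorem Comp.bound (hl : ∀ x, l x = inp x) : Comp fun x => bound (l x) := by
  simp only [hl]
  exact (Comp.const 3).getD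

theorem Comp.entry (hl : ∀ x, l x = inp x) (hf : Comp f) (hg : Comp g) :
    Comp fun x => entry (l x) (f x) (g x) := by
  have := ((Comp.const 4).add ((hf.mul (Comp.numVars hl)).add hg)).getD
  simp only [hl] at this ⊢
  exact this

theorem Comp.numValues (hl : ∀ x, l x = inp x) : Comp fun x => numValues (l x) :=
  (((Comp.numVars hl).add (Comp.numDom hl)).add (Comp.numActs hl)).add (.const 2)

theorem Comp.numSlots (hl : ∀ x, l x = inp x) : Comp fun x => numSlots (l x) :=
  ((Comp.bound hl).add (.const 3)).mul ((Comp.bound hl).add (.const 2))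

theorem Comp.slotVar (hl : ∀ x, l x = inp x) (hf : Comp f) (hg : Comp g) (hh : Comp h) :
    Comp fun x => slotVar (l x) (f x) (g x) (h x) :=
  (((hf.mul ((Comp.bound hl).add (.const 2))).add hg).mul (Comp.numValues hl)).add hh

theorem Comp.actVar (hl : ∀ x, l x = inp x) (hf : Comp f) (hg : Comp g) :
    Comp fun x => actVar (l x) (f x) (g x) :=
  Comp.slotVar hl (.const 0) hf hg

theorem Comp.trackVar (hl : ∀ x, l x = inp x) (hf : Comp f) (hg : Comp g) :
    Comp fun x => trackVar (l x) (f x) (g x) :=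
  Comp.slotVar hl (.const 1) hf hg

theorem Comp.valueVar (hl : ∀ x, l x = inp x) (hf : Comp f) (hg : Comp g) (hh : Comp h) :
    Comp fun x => valueVar (l x) (f x) (g x) (h x) :=
  Comp.slotVar hl ((Comp.const 2).add hf) hg hh

theorem Decides.goalGap (hl : ∀ x, l x = inp x) (hf : Comp f) (hg : Comp g) :
    Decides fun x => GoalGap (l x) (f x) (g x) := by
  have hl' : ∀ x : X × ℕ, l x.1 = inp x := fun x => hl x.1
  have hs : Comp fun x : X × ℕ => x.2 := .snd
  have h0 := Comp.entry hl' (.const 0) hs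
  have h1 := Comp.entry hl' (.const 1) hs
  exact .bex (Comp.numVars hl) (.and (.and (.lt hf.comp_fst (.add hs (.const 1)))
    (.lt (.add hs (.const 1)) hg.comp_fst)) (.and (.not (.eq h1 (.const 0))) (.not (.eq h1 h0))))

theorem Decides.actGap (hl : ∀ x, l x = inp x) (hf : Comp f) (hg : Comp g) (hh : Comp h) :
    Decides fun x => ActGap (l x) (f x) (g x) (h x) := by
  have hl' : ∀ x : X × ℕ, l x.1 = inp x := fun x => hl x.1
  have hs : Comp fun x : X × ℕ => x.2 := .snd
  have h0 := Comp.entry hl' (.const 0) hs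
  have h2 := Comp.entry hl' ((Comp.const 2).add (.mul (.const 2) hf.comp_fst)) hs
  have h3 := Comp.entry hl' ((Comp.const 3).add (.mul (.const 2) hf.comp_fst)) hs
  exact .bex (Comp.numVars hl) (.and (.and (.lt hg.comp_fst (.add hs (.const 1)))
    (.lt (.add hs (.const 1)) hh.comp_fst)) (.or (.not (.eq h3 (.const 0)))
      (.and (.not (.eq h2 (.const 0))) (.not (.eq h2 h0)))))

end

-- The clause lists consist of bounded iterations, guards and clauses of fixed length, so closure
-- lemmas apply along the syntax. The second pass treats indices and guards; `Comp.snd` and its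
-- weakenings are the loop variables.
set_option maxHeartbeats 1000000 in
theorem emitClauses_all : EmitClauses fun L => uniqueClauses L ++ planClauses L := by
  unfold planClauses uniqueClauses endClauses goalGapClauses actGapClauses initGoalClauses
    preEffClauses frameClauses
  repeat' first
    | exact Comp.numValues fun _ => rfl
    | exact Comp.numSlots fun _ => rfl
    | exact Comp.numVars fun _ => rfl
    | exact Comp.numActs fun _ => rfl
    | exact Comp.bound fun _ => rfl
    | exact (Comp.bound fun _ => rfl).add (.const _)
    | apply EmitClauses.append
    | apply EmitClauses.flatMap
    | apply EmitClauses.ite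
    | apply EmitClauses.clause₁
    | apply EmitClauses.clause₂
    | apply EmitClauses.clause₃
    | apply EmitClauses.clause₄
  all_goals repeat' first
    | exact Comp.snd
    | exact Comp.snd.comp_fst
    | exact Comp.snd.comp_fst.comp_fst
    | exact Comp.snd.comp_fst.comp_fst.comp_fst
    | exact Comp.snd.comp_fst.comp_fst.comp_fst.comp_fst
    | exact Comp.snd.comp_fst.comp_fst.comp_fst.comp_fst.comp_fst
    | exact Comp.const _
    | apply Comp.actVar fun _ => rfl
    | apply Comp.trackVar fun _ => rfl
    | apply Comp.valueVar fun _ => rfl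
    | apply Comp.entry fun _ => rfl
    | exact Comp.numValues fun _ => rfl
    | exact Comp.numVars fun _ => rfl
    | exact Comp.numDom fun _ => rfl
    | exact Comp.numActs fun _ => rfl
    | exact Comp.bound fun _ => rfl
    | apply Decides.goalGap fun _ => rfl
    | apply Decides.actGap fun _ => rfl
    | apply Decides.not
    | apply Decides.and
    | apply Decides.or
    | apply Decides.lt
    | apply Decides.eq
    | apply Comp.add
    | apply Comp.mul

theorem emit_outputCode : Emit outputCode := by
  have hl : ∀ L : List ℕ, L = Context.inp L := fun _ => rfl
  have h := emitClauses_all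
  exact (Emit.singleton ((Comp.numSlots hl).mul (Comp.numValues hl))).append
    ((Emit.singleton (Comp.numSlots hl)).append ((Emit.singleton h.1).append h.2))

/-! ## The weighted satisfiability instance as a constraint satisfaction problem -/

theorem forall_mem_listFor {α : Type} {n : ℕ} {f : ℕ → List α} {p : α → Prop} :
    (∀ C ∈ listFor n f, p C) ↔ ∀ i < n, ∀ C ∈ f i, p C := by
  simp only [listFor, List.mem_flatMap, List.mem_range]
  exact ⟨fun h i hi C hC => h C ⟨i, hi, hC⟩, fun h C ⟨i, hi, hC⟩ => h i hi C hC⟩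

theorem forall_mem_append {α : Type} {l m : List α} {p : α → Prop} :
    (∀ C ∈ l ++ m, p C) ↔ (∀ C ∈ l, p C) ∧ ∀ C ∈ m, p C := List.forall_mem_append

theorem forall_mem_ite_singleton {α : Type} {c : Prop} {inst : Decidable c} {D : α} {p : α → Prop} :
    (∀ C ∈ if c then [D] else [], p C) ↔ (c → p D) := by
  by_cases h : c <;> simp [h]

theorem slotVar_lt {L : List ℕ} {p q a : ℕ} (hp : p < bound L + 3) (hq : q < bound L + 2)
    (ha : a < numValues L) : slotVar L p q a < numSlots L * numValues L := by
  have h1 : p * (bound L + 2) + q < numSlots L := by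
    calc p * (bound L + 2) + q < (p + 1) * (bound L + 2) := by rw [Nat.succ_mul]; omega
      _ ≤ numSlots L := Nat.mul_le_mul_right _ hp
  calc slotVar L p q a < (p * (bound L + 2) + q + 1) * numValues L := by
        rw [Nat.succ_mul, slotVar]; omega
    _ ≤ _ := Nat.mul_le_mul_right _ h1

theorem numValues_pos (L : List ℕ) : 0 < numValues L := Nat.succ_pos _

theorem numVars_lt_numValues {L : List ℕ} {v : ℕ} (h : v < numVars L) : v + 1 < numValues L := by
  unfold numValues; omega

theorem numActs_lt_numValues {L : List ℕ} {a : ℕ} (h : a < numActs L) : a < numValues L := by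
  unfold numValues; omega

/-- The length 4 comes from the frame clauses. The range bound makes the reduction modulo `N` in
`negLiteral` harmless. -/
theorem bound_clauses (L : List ℕ) : ∀ C ∈ uniqueClauses L ++ planClauses L,
    C.length ≤ 4 ∧ ∀ v ∈ C, v < numSlots L * numValues L := by
  simp only [planClauses, uniqueClauses, endClauses, goalGapClauses, actGapClauses,
    initGoalClauses, preEffClauses, frameClauses, forall_mem_append, forall_mem_listFor,
    forall_mem_ite_singleton, List.forall_mem_cons, List.length_cons, List.length_nil,
    actVar, trackVar, valueVar]
  have hN : ∀ g < numSlots L, ∀ a < numValues L,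
      g * numValues L + a < numSlots L * numValues L := fun g hg a ha =>
    calc g * numValues L + a < (g + 1) * numValues L := by rw [Nat.succ_mul]; omega
      _ ≤ _ := Nat.mul_le_mul_right _ hg
  refine ⟨?_, ⟨⟨⟨⟨⟨?_, ?_⟩, ?_⟩, ?_⟩, ?_⟩, ?_⟩, ?_⟩
  · exact fun g hg a ha b hb _ => ⟨by omega, hN g hg a ha, hN g hg b hb, by simp⟩
  · exact fun y hy _ => ⟨by omega, slotVar_lt (by omega) (by omega) hy, by simp⟩
  · exact fun y hy _ => ⟨by omega, slotVar_lt (by omega) (by omega) hy, by simp⟩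
  · exact fun l hl y hy z hz _ => ⟨by omega, slotVar_lt (by omega) (by omega) hy,
      slotVar_lt (by omega) (by omega) hz, by simp⟩
  · exact fun t ht a ha l hl y hy z hz _ => ⟨by omega,
      slotVar_lt (by omega) (by omega) (numActs_lt_numValues ha),
      slotVar_lt (by omega) (by omega) hy, slotVar_lt (by omega) (by omega) hz, by simp⟩
  · exact fun l hl v hv e he => ⟨fun _ => ⟨by omega,
      slotVar_lt (by omega) (by omega) (numVars_lt_numValues hv),
      slotVar_lt (by omega) (by omega) he, by simp⟩, fun _ => ⟨by omega,
      slotVar_lt (by omega) (by omega) (numVars_lt_numValues hv),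
      slotVar_lt (by omega) (by omega) he, by simp⟩⟩
  · exact fun t ht a ha l hl v hv e he => ⟨fun _ => ⟨by omega,
      slotVar_lt (by omega) (by omega) (numActs_lt_numValues ha),
      slotVar_lt (by omega) (by omega) (numVars_lt_numValues hv),
      slotVar_lt (by omega) (by omega) he, by simp⟩, fun _ => ⟨by omega,
      slotVar_lt (by omega) (by omega) (numActs_lt_numValues ha),
      slotVar_lt (by omega) (by omega) (numVars_lt_numValues hv),
      slotVar_lt (by omega) (by omega) he, by simp⟩⟩
  · exact fun t ht a ha l hl v hv e he e' he' _ => ⟨by omega,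
      slotVar_lt (by omega) (by omega) ha,
      slotVar_lt (by omega) (by omega) (numVars_lt_numValues hv),
      slotVar_lt (by omega) (by omega) he, slotVar_lt (by omega) (by omega) he', by simp⟩

theorem numSlots_mul_numValues_pos (L : List ℕ) : 0 < numSlots L * numValues L :=
  Nat.mul_pos (Nat.mul_pos (Nat.succ_pos _) (Nat.succ_pos _)) (numValues_pos L)

/-- The negative literal of the variable `v`. -/
def negLiteral {N : ℕ} (hN : 0 < N) (v : ℕ) : Fin N × Bool := (⟨v % N, Nat.mod_lt _ hN⟩, false)

/-- The weighted satisfiability instance for the list `L` of the numbers in the code of a planning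
instance. -/
noncomputable def satInstance (L : List ℕ) : WeightedSATInstance where
  numVars := numSlots L * numValues L
  formula := (uniqueClauses L ++ planClauses L).map fun C =>
    C.map (negLiteral (numSlots_mul_numValues_pos L))
  k := numSlots L

theorem code_satInstance (L : List ℕ) : (satInstance L).code = bits (outputCode L) := by
  have h : ∀ F : List (List ℕ), (∀ C ∈ F, ∀ v ∈ C, v < numSlots L * numValues L) →
      (F.map fun C => C.map (negLiteral (numSlots_mul_numValues_pos L))).flatMap
        (codeList WeightedSATInstance.codeLiteral) = F.flatMap codeClause := by
    intro F hF
    rw [List.flatMap_map]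
    refine List.flatMap_congr fun C hC => ?_
    simp only [codeClause, codeList, List.length_map]
    rw [List.flatMap_map]
    refine congrArg _ (List.flatMap_congr fun v hv => ?_)
    simp [WeightedSATInstance.codeLiteral, negLiteral, Nat.mod_eq_of_lt (hF C hC v hv)]
  have h' := h _ fun C hC => (bound_clauses L C hC).2
  simp only [WeightedSATInstance.code, satInstance, outputCode, codeList, List.length_map]
  exact congrArg (fun l => bits (_ :: _ :: _ :: l)) h'

/-- The choice of values `h` for the slots satisfies the clause `C`. -/
def SlotSat (S : ℕ) (h : ℕ → ℕ) (C : List ℕ) : Prop := ∃ v ∈ C, ¬ h (v / S) = v % S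

theorem satInstance_solvable_iff_exists (L : List ℕ) : (satInstance L).Solvable ↔
    ∃ τ : Fin (numSlots L * numValues L) → Bool,
      (∀ C ∈ uniqueClauses L ++ planClauses L,
        ∃ v ∈ C, ∃ hv : v < numSlots L * numValues L, τ ⟨v, hv⟩ = false) ∧
      (Finset.univ.filter fun i => τ i = true).card = numSlots L := by
  have h : ∀ τ : Fin (numSlots L * numValues L) → Bool,
      CNF.SatisfiedBy ((uniqueClauses L ++ planClauses L).map fun C =>
        C.map (negLiteral (numSlots_mul_numValues_pos L))) τ ↔
      ∀ C ∈ uniqueClauses L ++ planClauses L,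
        ∃ v ∈ C, ∃ hv : v < numSlots L * numValues L, τ ⟨v, hv⟩ = false := by
    intro τ
    constructor
    · intro h C hC
      obtain ⟨l, hl, e⟩ := h _ (List.mem_map_of_mem hC)
      obtain ⟨v, hv, rfl⟩ := List.mem_map.1 hl
      have hb := (bound_clauses L C hC).2 v hv
      refine ⟨v, hv, hb, ?_⟩
      simpa [negLiteral, Nat.mod_eq_of_lt hb] using e
    · intro h D hD
      obtain ⟨C, hC, rfl⟩ := List.mem_map.1 hD
      obtain ⟨v, hv, hb, e⟩ := h C hC
      refine ⟨_, List.mem_map_of_mem hv, ?_⟩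
      simpa [negLiteral, Nat.mod_eq_of_lt hb] using e
  exact exists_congr fun τ => and_congr (h τ) Iff.rfl

/-- Quotient and remainder by `numValues L` give the slot and the value of a propositional variable.
At most one true variable per slot and as many true variables as slots leave exactly one per slot.
-/
theorem satInstance_solvable_iff (L : List ℕ) : (satInstance L).Solvable ↔
    ∃ h : ℕ → ℕ, (∀ g, h g < numValues L) ∧ ∀ C ∈ planClauses L, SlotSat (numValues L) h C := by
  rw [satInstance_solvable_iff_exists]
  have hS := numValues_pos L
  set S := numValues L with hSdef
  set G := numSlots L with hGdef
  have hlt : ∀ g < G, ∀ a < S, g * S + a < G * S := fun g hg a ha =>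
    calc g * S + a < (g + 1) * S := by rw [Nat.succ_mul]; omega
      _ ≤ _ := Nat.mul_le_mul_right _ hg
  have hdiv : ∀ g, ∀ a < S, (g * S + a) / S = g := fun g a ha => by
    rw [mul_comm, Nat.mul_add_div hS, Nat.div_eq_of_lt ha, add_zero]
  have hmod : ∀ g, ∀ a < S, (g * S + a) % S = a := fun g a ha => by
    rw [mul_comm, Nat.mul_add_mod, Nat.mod_eq_of_lt ha]
  have hlt' : ∀ i : Fin (G * S), i.1 / S < G := fun i =>
    Nat.div_lt_of_lt_mul (i.2.trans_eq (mul_comm G S))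
  have hdm : ∀ i, i / S * S + i % S = i := fun i => by rw [mul_comm, Nat.div_add_mod]
  constructor
  · rintro ⟨τ, hτ', hcard⟩
    rw [forall_mem_append] at hτ'
    obtain ⟨hu, hp⟩ := hτ'
    have huniq : ∀ i j : Fin (G * S), τ i = true → τ j = true → i.1 / S = j.1 / S →
        ¬ i.1 % S < j.1 % S := by
      intro i j hi hj e hij
      simp only [uniqueClauses, forall_mem_listFor, forall_mem_ite_singleton] at hu
      obtain ⟨v, hv, hvN, hf⟩ := hu (i.1 / S) (hlt' i)
        (i.1 % S) (Nat.mod_lt _ hS) (j.1 % S) (Nat.mod_lt _ hS) hij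
      simp only [← hSdef, List.mem_cons, List.not_mem_nil, or_false] at hv
      rcases hv with rfl | rfl
      · have : (⟨_, hvN⟩ : Fin (G * S)) = i := Fin.ext (hdm i)
        rw [this, hi] at hf
        simp at hf
      · have : (⟨_, hvN⟩ : Fin (G * S)) = j := Fin.ext (by simp only; rw [e]; exact hdm j)
        rw [this, hj] at hf
        simp at hf
    have hinj : Set.InjOn (fun i : Fin (G * S) => i.1 / S)
        (Finset.univ.filter fun i : Fin (G * S) => τ i = true) := by
      intro i hi j hj e
      simp only [Finset.coe_filter, Finset.mem_univ, true_and, Set.mem_ofPred_eq] at hi hj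
      have h1 := huniq i j hi hj e
      have h2 := huniq j i hj hi e.symm
      have e : i.1 / S = j.1 / S := e
      apply Fin.ext
      rw [← hdm i, ← hdm j, e, show i.1 % S = j.1 % S by omega]
    -- Pigeonhole: the slots of the `G` true variables are distinct members of a set of size `G`, so
    -- each slot occurs.
    have himg : (Finset.univ.filter fun i : Fin (G * S) => τ i = true).image
        (fun i : Fin (G * S) => i.1 / S) = Finset.range G := by
      apply Finset.eq_of_subset_of_card_le
      · intro g hg
        obtain ⟨i, -, rfl⟩ := Finset.mem_image.1 hg
        exact Finset.mem_range.2 (hlt' i)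
      · rw [Finset.card_image_of_injOn hinj, hcard, Finset.card_range]
    have hex : ∀ g, ∃ a < S, ∀ hg : g < G, ∀ ha : g * S + a < G * S, τ ⟨g * S + a, ha⟩ = true := by
      intro g
      by_cases hg : g < G
      · have := himg ▸ Finset.mem_range.2 hg
        obtain ⟨i, hi, e⟩ := Finset.mem_image.1 this
        refine ⟨i.1 % S, Nat.mod_lt _ hS, fun _ ha => ?_⟩
        have hi' : τ i = true := by simpa using hi
        rw [← hi']
        congr 1
        exact Fin.ext (by simp only; rw [← e]; exact hdm i)
      · exact ⟨0, hS, fun h => absurd h hg⟩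
    choose h hh1 hh2 using hex
    refine ⟨h, hh1, fun C hC => ?_⟩
    obtain ⟨v, hv, hvN, hf⟩ := hp C hC
    refine ⟨v, hv, fun e => ?_⟩
    have hg : v / S < G := Nat.div_lt_of_lt_mul (hvN.trans_eq (mul_comm G S))
    have e2 : v / S * S + h (v / S) = v := by rw [e]; exact hdm v
    have := hh2 (v / S) hg (by rw [e2]; exact hvN)
    simp only [e2, hf] at this
    simp at this
  · rintro ⟨h, hh, hC⟩
    refine ⟨fun i => decide (h (i.1 / S) = i.1 % S), ?_, ?_⟩
    · rw [forall_mem_append]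
      constructor
      · simp only [uniqueClauses, forall_mem_listFor, forall_mem_ite_singleton]
        intro g hg a ha b hb hab
        rw [← hSdef] at ha hb
        by_cases e : h g = a
        · refine ⟨g * S + b, by simp [hSdef], hlt g hg b hb, ?_⟩
          simp [hdiv g b hb, hmod g b hb]
          omega
        · refine ⟨g * S + a, by simp [hSdef], hlt g hg a ha, ?_⟩
          simpa [hdiv g a ha, hmod g a ha] using e
      · intro C hCm
        obtain ⟨v, hv, e⟩ := hC C hCm
        exact ⟨v, hv, (bound_clauses L C (by simp [hCm])).2 v hv, by simpa using e⟩
    · have hinj : Function.Injective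
          fun g : Fin G => (⟨g * S + h g, hlt g g.2 _ (hh g)⟩ : Fin (G * S)) := by
        intro g g' e
        have e' := congrArg (fun i : Fin (G * S) => i.1 / S) e
        simp only [hdiv _ _ (hh _)] at e'
        exact Fin.ext e'
      have : (Finset.univ.filter fun i : Fin (G * S) =>
          decide (h (i.1 / S) = i.1 % S) = true) = Finset.univ.map ⟨_, hinj⟩ := by
        ext i
        rw [Finset.mem_filter, Finset.mem_map, decide_eq_true_eq]
        constructor
        · rintro ⟨-, e⟩
          exact ⟨⟨i.1 / S, hlt' i⟩, Finset.mem_univ _, Fin.ext (by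
            change i.1 / S * S + h (i.1 / S) = i.1
            rw [e]; exact hdm i)⟩
        · rintro ⟨g, -, rfl⟩
          refine ⟨Finset.mem_univ _, ?_⟩
          change h ((g.1 * S + h g.1) / S) = (g.1 * S + h g.1) % S
          rw [hdiv _ _ (hh _), hmod _ _ (hh _)]
      rw [this, Finset.card_map, Finset.card_univ, Fintype.card_fin]

/-- The constraints on the actions `A t`, the tracked variables `V l` and the values `Z t l`. -/
structure PlanConstraints (L : List ℕ) (A V : ℕ → ℕ) (Z : ℕ → ℕ → ℕ) : Prop where
  first : V 0 = 0
  last : V (bound L + 1) = numVars L + 1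
  goalGap : ∀ l < bound L + 1, ¬ GoalGap L (V l) (V (l + 1))
  actGap : ∀ t < bound L, A t < numActs L → ∀ l < bound L + 1, ¬ ActGap L (A t) (V l) (V (l + 1))
  init : ∀ l < bound L + 2, ∀ v < numVars L, V l = v + 1 → Z 0 l = entry L 0 v
  goal : ∀ l < bound L + 2, ∀ v < numVars L, V l = v + 1 → entry L 1 v ≠ 0 →
    Z (bound L) l = entry L 1 v
  pre : ∀ t < bound L, A t < numActs L → ∀ l < bound L + 2, ∀ v < numVars L, V l = v + 1 →
    entry L (2 + 2 * A t) v ≠ 0 → Z t l = entry L (2 + 2 * A t) v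
  eff : ∀ t < bound L, A t < numActs L → ∀ l < bound L + 2, ∀ v < numVars L, V l = v + 1 →
    entry L (3 + 2 * A t) v ≠ 0 → Z (t + 1) l = entry L (3 + 2 * A t) v
  frame : ∀ t < bound L, ∀ l < bound L + 2, ∀ v < numVars L, V l = v + 1 →
    (¬ A t < numActs L ∨ entry L (3 + 2 * A t) v = 0) → Z (t + 1) l = Z t l

/-- The value of the slot `(p, q)`. -/
def slotValue (L : List ℕ) (h : ℕ → ℕ) (p q : ℕ) : ℕ := h (p * (bound L + 2) + q)

theorem slotVar_holds_iff {L : List ℕ} {h : ℕ → ℕ} {p q a : ℕ} (ha : a < numValues L) :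
    h (slotVar L p q a / numValues L) = slotVar L p q a % numValues L ↔
      slotValue L h p q = a := by
  rw [slotVar, mul_comm _ (numValues L), Nat.mul_add_div (numValues_pos L), Nat.div_eq_of_lt ha,
    Nat.mul_add_mod, Nat.mod_eq_of_lt ha]
  rfl

theorem planClauses_sat_iff {L : List ℕ} {h : ℕ → ℕ} (hh : ∀ g, h g < numValues L) :
    (∀ C ∈ planClauses L, SlotSat (numValues L) h C) ↔
      PlanConstraints L (slotValue L h 0) (slotValue L h 1) fun t => slotValue L h (2 + t) := by
  have hs : ∀ p q, slotValue L h p q < numValues L := fun p q => hh _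
  have key : ∀ {p q a}, a < numValues L →
      (h (slotVar L p q a / numValues L) = slotVar L p q a % numValues L ↔
        slotValue L h p q = a) := slotVar_holds_iff
  simp only [planClauses, endClauses, goalGapClauses, actGapClauses,
    initGoalClauses, preEffClauses, frameClauses, forall_mem_append, forall_mem_listFor,
    forall_mem_ite_singleton, SlotSat, List.exists_mem_cons_iff, List.not_mem_nil, false_and,
    exists_false, or_false, actVar, trackVar, valueVar]
  constructor
  · rintro ⟨⟨⟨⟨⟨⟨h1, h2⟩, h3⟩, h4⟩, h5⟩, h6⟩, h7⟩
    refine ⟨?_, ?_, ?_, ?_, ?_, ?_, ?_, ?_, ?_⟩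
    · by_contra e
      exact h1 _ (hs _ _) e ((key (hs _ _)).2 rfl)
    · by_contra e
      exact h2 _ (hs _ _) e ((key (hs _ _)).2 rfl)
    · intro l hl e
      have := h3 l hl _ (hs _ _) _ (hs _ _) e
      rw [key (hs _ _), key (hs _ _)] at this
      simp at this
    · intro t ht ha l hl e
      have := h4 t ht _ ha l hl _ (hs _ _) _ (hs _ _) e
      rw [key (hs _ _), key (hs _ _), key (hs _ _)] at this
      simp at this
    · intro l hl v hv e
      by_contra e'
      have := (h5 l hl v hv _ (hs _ _)).1 (Ne.symm e')
      rw [key (numVars_lt_numValues hv), key (hs _ _)] at this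
      simp [e] at this
    · intro l hl v hv e e0
      by_contra e'
      have := (h5 l hl v hv _ (hs _ _)).2 ⟨e0, Ne.symm e'⟩
      rw [key (numVars_lt_numValues hv), key (hs _ _)] at this
      simp [e] at this
    · intro t ht ha l hl v hv e e0
      by_contra e'
      have := (h6 t ht _ ha l hl v hv _ (hs _ _)).1 ⟨e0, Ne.symm e'⟩
      rw [key (hs _ _), key (numVars_lt_numValues hv), key (hs _ _)] at this
      simp [e] at this
    · intro t ht ha l hl v hv e e0
      by_contra e'
      have := (h6 t ht _ ha l hl v hv _ (hs _ _)).2 ⟨e0, Ne.symm e'⟩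
      rw [key (hs _ _), key (numVars_lt_numValues hv), key (hs _ _)] at this
      simp [e] at this
    · intro t ht l hl v hv e e0
      by_contra e'
      have := h7 t ht _ (hs _ _) l hl v hv _ (hs _ _) _ (hs _ _) ⟨e0, Ne.symm e'⟩
      rw [key (hs _ _), key (numVars_lt_numValues hv), key (hs _ _), key (hs _ _)] at this
      simp [e] at this
  · intro H
    refine ⟨⟨⟨⟨⟨⟨?_, ?_⟩, ?_⟩, ?_⟩, ?_⟩, ?_⟩, ?_⟩
    · intro y hy hy0
      rw [key hy, H.first]
      exact Ne.symm hy0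
    · intro y hy hy0
      rw [key hy, H.last]
      exact Ne.symm hy0
    · intro l hl y hy z hz e
      rw [key hy, key hz]
      by_contra! h'
      obtain ⟨rfl, rfl⟩ := h'
      exact H.goalGap l hl e
    · intro t ht a ha l hl y hy z hz e
      rw [key (numActs_lt_numValues ha), key hy, key hz]
      by_contra! h'
      obtain ⟨rfl, rfl, rfl⟩ := h'
      exact H.actGap t ht ha l hl e
    · intro l hl v hv e he
      rw [key (numVars_lt_numValues hv), key he, key he]
      constructor
      · intro e'
        by_contra! h'
        exact e' ((H.init l hl v hv h'.1).symm.trans h'.2)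
      · intro e'
        by_contra! h'
        exact e'.2 ((H.goal l hl v hv h'.1 e'.1).symm.trans h'.2)
    · intro t ht a ha l hl v hv e he
      rw [key (numActs_lt_numValues ha), key (numVars_lt_numValues hv), key he, key he]
      constructor
      · intro e'
        by_contra! h'
        obtain ⟨rfl, h1, h2⟩ := h'
        exact e'.2 ((H.pre t ht ha l hl v hv h1 e'.1).symm.trans h2)
      · intro e'
        by_contra! h'
        obtain ⟨rfl, h1, h2⟩ := h'
        exact e'.2 ((H.eff t ht ha l hl v hv h1 e'.1).symm.trans h2)
    · intro t ht a ha l hl v hv e he e' he' c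
      rw [key ha, key (numVars_lt_numValues hv), key he, key he']
      by_contra! h'
      obtain ⟨rfl, h1, h2, h3⟩ := h'
      exact c.2 (h2.symm.trans ((H.frame t ht l hl v hv h1 c.1).symm.trans h3))

/-- The values of the slots can be chosen freely. -/
theorem satInstance_solvable_iff_constraints (L : List ℕ) : (satInstance L).Solvable ↔
    ∃ (A V : ℕ → ℕ) (Z : ℕ → ℕ → ℕ), (∀ t < bound L, A t < numValues L) ∧
      (∀ l < bound L + 2, V l < numValues L) ∧
      (∀ t < bound L + 1, ∀ l < bound L + 2, Z t l < numValues L) ∧ PlanConstraints L A V Z := by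
  rw [satInstance_solvable_iff L]
  constructor
  · rintro ⟨h, hh, hC⟩
    exact ⟨_, _, _, fun _ _ => hh _, fun _ _ => hh _, fun _ _ _ _ => hh _,
      (planClauses_sat_iff hh).1 hC⟩
  · rintro ⟨A, V, Z, hA, hV, hZ, H⟩
    set K := bound L + 2 with hK
    have hdiv : ∀ p, ∀ q < K, (p * K + q) / K = p := fun p q hq => by
      rw [mul_comm, Nat.mul_add_div (by omega), Nat.div_eq_of_lt hq, add_zero]
    have hmod : ∀ p, ∀ q < K, (p * K + q) % K = q := fun p q hq => by
      rw [mul_comm, Nat.mul_add_mod, Nat.mod_eq_of_lt hq]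
    let f : ℕ → ℕ → ℕ := fun p q => match p with
      | 0 => A q
      | 1 => V q
      | p + 2 => Z p q
    -- The bounds on `A`, `V` and `Z` cover only the cells that the constraints read; too large
    -- values elsewhere are replaced by `0`.
    let h : ℕ → ℕ := fun g => if f (g / K) (g % K) < numValues L then f (g / K) (g % K) else 0
    have hh : ∀ g, h g < numValues L := fun g => by
      simp only [h]
      split_ifs with hg
      · exact hg
      · exact numValues_pos L
    have e : ∀ p, ∀ q < K, f p q < numValues L → slotValue L h p q = f p q := fun p q hq hf => by
      simp only [slotValue, h, ← hK, hdiv p q hq, hmod p q hq, hf, if_true]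
    refine ⟨h, hh, (planClauses_sat_iff hh).2 ?_⟩
    have eA : ∀ t < bound L, slotValue L h 0 t = A t := fun t ht => e 0 t (by omega) (hA t ht)
    have eV : ∀ l < bound L + 2, slotValue L h 1 l = V l := fun l hl => e 1 l hl (hV l hl)
    have eZ : ∀ t < bound L + 1, ∀ l < bound L + 2, slotValue L h (2 + t) l = Z t l :=
      fun t ht l hl => by
        rw [add_comm]
        exact e (t + 2) l hl (hZ t ht l hl)
    constructor
    · rw [eV 0 (by omega)]; exact H.first
    · rw [eV _ (by omega)]; exact H.last
    · intro l hl
      rw [eV _ (by omega), eV _ (by omega)]; exact H.goalGap l hl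
    · intro t ht
      rw [eA t ht]
      intro ha l hl
      rw [eV _ (by omega), eV _ (by omega)]; exact H.actGap t ht ha l hl
    · intro l hl v hv
      rw [eV _ hl, eZ 0 (by omega) l hl]; exact H.init l hl v hv
    · intro l hl v hv
      rw [eV _ hl, eZ _ (by omega) l hl]; exact H.goal l hl v hv
    · intro t ht
      rw [eA t ht]
      intro ha l hl v hv
      rw [eV _ hl, eZ t (by omega) l hl]; exact H.pre t ht ha l hl v hv
    · intro t ht
      rw [eA t ht]
      intro ha l hl v hv
      rw [eV _ hl, eZ _ (by omega) l hl]; exact H.eff t ht ha l hl v hv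
    · intro t ht l hl v hv
      rw [eA t ht, eV _ hl, eZ t (by omega) l hl, eZ _ (by omega) l hl]
      exact H.frame t ht l hl v hv

/-! ## The constraints express the planning problem -/

/-- Rows of equal length are stored in row-major order; a missing row gives the default on both
sides. -/
theorem getD_flatten {α : Type} (d : α) {n v : ℕ} (hv : v < n) :
    ∀ (R : List (List α)) (_ : ∀ r ∈ R, r.length = n) (i : ℕ),
      R.flatten.getD (i * n + v) d = (R.getD i []).getD v d := by
  intro R
  induction R with
  | nil => intro _ i; simp
  | cons r R ih =>
    intro h i
    have hr : r.length = n := h r (by simp)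
    cases i with
    | zero =>
      rw [List.flatten_cons, Nat.zero_mul, Nat.zero_add, List.getD_append _ _ _ _ (by omega)]
      rfl
    | succ i =>
      rw [List.flatten_cons, List.getD_append_right _ _ _ _ (by rw [hr, Nat.succ_mul]; omega)]
      have e : (i + 1) * n + v - r.length = i * n + v := by rw [hr, Nat.succ_mul]; omega
      rw [e, ih (fun r hr => h r (by simp [hr]))]
      rfl

/-! ### Reading a planning instance off its code. -/

namespace PlanningInstance

variable (x : PlanningInstance)

/-- The partial states in the code of a planning instance. -/
def rows : List (List ℕ) :=
  codePartial (fun v => some (x.plan.init v)) :: codePartial x.plan.goal ::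
    (List.ofFn fun a => [codePartial (x.plan.pre a), codePartial (x.plan.eff a)]).flatten

/-- The numbers in the code of a planning instance. -/
def numbers : List ℕ := x.n :: x.d :: x.m :: x.k :: x.rows.flatten

theorem code_eq : x.code = bits x.numbers := by
  simp only [code, numbers, rows, List.flatten_cons, List.flatten_flatten, List.map_ofFn]
  have : (fun a => codePartial (x.plan.pre a) ++ codePartial (x.plan.eff a)) =
      List.flatten ∘ fun a => [codePartial (x.plan.pre a), codePartial (x.plan.eff a)] := by
    funext a
    simp
  rw [this]

theorem length_row {r : List ℕ} (hr : r ∈ x.rows) : r.length = x.n := by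
  simp only [rows, List.mem_cons, List.mem_flatten, List.mem_ofFn] at hr
  rcases hr with rfl | rfl | ⟨_, ⟨a, rfl⟩, h⟩
  · simp [codePartial]
  · simp [codePartial]
  · simp only [List.mem_cons, List.not_mem_nil, or_false] at h
    rcases h with rfl | rfl <;> simp [codePartial]

theorem entry_eq (i : ℕ) (v : Fin x.n) :
    entry x.numbers i v = (x.rows.getD i []).getD v 0 := by
  have h : entry x.numbers i v = x.rows.flatten.getD (i * x.n + v) 0 := by
    have e : 4 + (i * x.n + v) = (i * x.n + v) + 1 + 1 + 1 + 1 := by omega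
    simp only [entry, numVars, numbers, List.getD_cons_zero, e, List.getD_cons_succ]
  rw [h, getD_flatten 0 v.2 _ fun r hr => x.length_row hr]

theorem getD_codePartial {n d : ℕ} (p : PartialState (Fin n) (Fin d)) (v : Fin n) :
    (codePartial p).getD v 0 = codeOption (p v) := by
  simp [codePartial, List.getD_eq_getElem?_getD]

theorem entry_init (v : Fin x.n) : entry x.numbers 0 v = x.plan.init v + 1 := by
  rw [entry_eq]
  exact getD_codePartial _ v

theorem entry_goal (v : Fin x.n) : entry x.numbers 1 v = codeOption (x.plan.goal v) := by
  rw [entry_eq]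
  exact getD_codePartial _ v

/-- `getD_flatten` one level up: each action contributes a block of two rows. -/
theorem getD_rows (a : Fin x.m) (b : ℕ) (hb : b < 2) :
    x.rows.getD (2 + b + 2 * a) [] =
      [codePartial (x.plan.pre a), codePartial (x.plan.eff a)].getD b [] := by
  have e : 2 + b + 2 * (a : ℕ) = (a * 2 + b) + 1 + 1 := by omega
  rw [rows, e, List.getD_cons_succ, List.getD_cons_succ, getD_flatten [] hb]
  · congr 1
    simp [List.getD_eq_getElem?_getD]
  · intro r hr
    obtain ⟨a, rfl⟩ := List.mem_ofFn.1 hr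
    rfl

theorem entry_pre (a : Fin x.m) (v : Fin x.n) :
    entry x.numbers (2 + 2 * a) v = codeOption (x.plan.pre a v) := by
  rw [entry_eq, x.getD_rows a 0 (by omega)]
  exact getD_codePartial _ v

theorem entry_eff (a : Fin x.m) (v : Fin x.n) :
    entry x.numbers (3 + 2 * a) v = codeOption (x.plan.eff a v) := by
  rw [entry_eq, x.getD_rows a 1 (by omega)]
  exact getD_codePartial _ v

end PlanningInstance

theorem codeOption_eq_zero {d : ℕ} {o : Option (Fin d)} : codeOption o = 0 ↔ o = none := by
  cases o <;> simp [codeOption]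

theorem codeOption_eq_succ {d : ℕ} {o : Option (Fin d)} {e : Fin d} :
    codeOption o = e + 1 ↔ o = some e := by
  cases o <;> simp [codeOption, Fin.ext_iff]

/-! ### Plans as walks with idle steps. -/

namespace SASPlus

variable {V D : Type} {m : ℕ} (I : SASPlus V D (Fin m))

/-- Execute the action `a`, or nothing if `a` is not the number of an action. -/
def step (a : ℕ) (s : State V D) : State V D := if h : a < m then I.result ⟨a, h⟩ s else s

/-- The state after the first `t` steps of the sequence `A`. -/
def walk (A : ℕ → ℕ) (s : State V D) : ℕ → State V D
  | 0 => s
  | t + 1 => I.step (A t) (walk A s t)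

/-- Peels off the first step, as `IsPlanFromTo` does, whereas `walk` recurses on the last one. -/
theorem walk_succ (A : ℕ → ℕ) (s : State V D) (t : ℕ) :
    I.walk A s (t + 1) = I.walk (fun i => A (i + 1)) (I.step (A 0) s) t := by
  induction t with
  | zero => rfl
  | succ t ih => rw [walk, ih]; rfl

/-- All actions of `A` before the time `k` are valid. -/
def ValidWalk (A : ℕ → ℕ) (s : State V D) (k : ℕ) : Prop :=
  ∀ t < k, ∀ h : A t < m, I.Valid ⟨A t, h⟩ (I.walk A s t)

/-- Idle steps are dropped, so the plan may be shorter than the walk. -/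
theorem exists_plan_of_validWalk {k : ℕ} : ∀ {A : ℕ → ℕ} {s : State V D}, I.ValidWalk A s k →
    ∃ π : List (Fin m), π.length ≤ k ∧ I.IsPlanFromTo s π (I.walk A s k) := by
  induction k with
  | zero => intro A s _; exact ⟨[], le_rfl, rfl⟩
  | succ k ih =>
    intro A s hA
    obtain ⟨π, hπ, h⟩ := ih (A := fun i => A (i + 1)) (s := I.step (A 0) s) fun t ht ha => by
      rw [← walk_succ]
      exact hA (t + 1) (by omega) ha
    rw [← walk_succ] at h
    by_cases h0 : A 0 < m
    · refine ⟨⟨A 0, h0⟩ :: π, by simpa using hπ, hA 0 (by omega) h0, ?_⟩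
      simpa only [step, h0, dif_pos] using h
    · refine ⟨π, by omega, ?_⟩
      have : I.step (A 0) s = s := by simp [step, h0]
      rwa [this] at h

/-- A plan that ends early is padded with the idle value `m`. -/
theorem exists_validWalk_of_plan {k : ℕ} {t : State V D} : ∀ {π : List (Fin m)} {s : State V D},
    π.length ≤ k → I.IsPlanFromTo s π t →
      ∃ A : ℕ → ℕ, (∀ i, A i ≤ m) ∧ I.ValidWalk A s k ∧ I.walk A s k = t := by
  induction k with
  | zero =>
    intro π s hπ h
    obtain rfl : π = [] := List.length_eq_zero_iff.1 (by omega)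
    exact ⟨fun _ => m, fun _ => le_rfl, fun t ht => by omega, h⟩
  | succ k ih =>
    intro π s hπ h
    cases π with
    | nil =>
      obtain ⟨A, hA, hv, hw⟩ := ih (π := []) (s := s) (by simp) h
      have e : I.step m s = s := by simp [step]
      refine ⟨fun i => i.casesOn m A, fun i => ?_, fun i hi ha => ?_, ?_⟩
      · cases i with
        | zero => exact le_rfl
        | succ i => exact hA i
      · cases i with
        | zero => exact absurd ha (lt_irrefl _)
        | succ i => rw [walk_succ]; change I.Valid _ (I.walk A (I.step m s) i); rw [e]; exact hv i (by omega) ha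
      · rw [walk_succ]; change I.walk A (I.step m s) k = t; rw [e]; exact hw
    | cons a π =>
      obtain ⟨A, hA, hv, hw⟩ := ih (by simpa using hπ) h.2
      have e : I.step a s = I.result a s := by simp [step]
      refine ⟨fun i => i.casesOn a A, fun i => ?_, fun i hi ha => ?_, ?_⟩
      · cases i with
        | zero => exact a.2.le
        | succ i => exact hA i
      · cases i with
        | zero => exact h.1
        | succ i => rw [walk_succ]; change I.Valid _ (I.walk A (I.step a s) i); rw [e]; exact hv i (by omega) ha
      · rw [walk_succ]; change I.walk A (I.step a s) k = t; rw [e]; exact hw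

end SASPlus

/-! ### From the constraints to a plan. -/

/-- If a sequence starts below `y` and ends above `y` without meeting `y`, then it steps over `y`. -/
theorem exists_gap {V : ℕ → ℕ} {y N : ℕ} (h0 : V 0 < y) (hN : y < V N) (hy : ∀ l < N, V l ≠ y) :
    ∃ l < N, V l < y ∧ y < V (l + 1) := by
  by_contra! h
  have : ∀ l ≤ N, V l ≤ y := by
    intro l hl
    induction l with
    | zero => exact h0.le
    | succ l ih => exact h l hl (lt_of_le_of_ne (ih (by omega)) (hy l hl))
  exact absurd (this N le_rfl) (by omega)

/-- The walk along `A` is the plan. `V` need not be increasing: an untracked variable is stepped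
over at some position, and the gap constraints there protect it. -/
theorem PlanConstraints.solvable {x : PlanningInstance} {A V : ℕ → ℕ} {Z : ℕ → ℕ → ℕ}
    (H : PlanConstraints x.numbers A V Z) : x.Solvable := by
  obtain ⟨h1, h2, h3, h4, h5, h6, h7, h8, h9⟩ := H
  change V (x.k + 1) = x.n + 1 at h2
  change ∀ l < x.k + 1, _ at h3
  change ∀ t < x.k, A t < x.m → ∀ l < x.k + 1, _ at h4
  change ∀ l < x.k + 2, ∀ v < x.n, _ at h5
  change ∀ l < x.k + 2, ∀ v < x.n, V l = v + 1 → _ → Z x.k l = _ at h6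
  change ∀ t < x.k, A t < x.m → ∀ l < x.k + 2, ∀ v < x.n, _ at h7 h8
  change ∀ t < x.k, ∀ l < x.k + 2, ∀ v < x.n, _ → (¬ A t < x.m ∨ _) → _ at h9
  set s := x.plan.walk A x.plan.init with hs
  have gap : ∀ v : Fin x.n, (∃ l < x.k + 2, V l = v + 1) ∨
      ((∀ l < x.k + 2, V l ≠ v + 1) ∧ ∃ l < x.k + 1, V l < v + 1 ∧ v + 1 < V (l + 1)) := by
    intro v
    by_cases h : ∃ l < x.k + 2, V l = v + 1
    · exact Or.inl h
    · push Not at h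
      have := v.2
      exact Or.inr ⟨h, exists_gap (by omega) (by omega) fun l hl => h l (by omega)⟩
  have untouched : ∀ t < x.k, ∀ ha : A t < x.m, ∀ v : Fin x.n, (∀ l < x.k + 2, V l ≠ v + 1) →
      x.plan.eff ⟨A t, ha⟩ v = none ∧ (x.plan.pre ⟨A t, ha⟩ v ≠ none →
        x.plan.pre ⟨A t, ha⟩ v = some (x.plan.init v)) := by
    intro t ht ha v hv
    obtain ⟨l, hl, hl1⟩ := ((gap v).resolve_left (by push Not; exact hv)).2
    have h := h4 t ht ha l hl
    simp only [ActGap, not_exists, not_and, not_or, not_not] at h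
    have h' := h v v.2 hl1
    have e1 := x.entry_eff ⟨A t, ha⟩ v
    have e2 := x.entry_pre ⟨A t, ha⟩ v
    simp only at e1 e2
    rw [e1, e2, x.entry_init, codeOption_eq_zero, codeOption_eq_zero, codeOption_eq_succ] at h'
    exact h'
  -- Tracked variables follow `Z`, where `+ 1` is the shift in `codeOption`; untracked ones keep
  -- their initial value.
  have inv : ∀ t ≤ x.k, ∀ v : Fin x.n,
      (∀ l < x.k + 2, V l = v + 1 → Z t l = s t v + 1) ∧
      ((∀ l < x.k + 2, V l ≠ v + 1) → s t v = x.plan.init v) := by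
    intro t ht
    induction t with
    | zero =>
      refine fun v => ⟨fun l hl e => ?_, fun _ => rfl⟩
      rw [h5 l hl v v.2 e, x.entry_init]; rfl
    | succ t ih =>
      intro v
      have ih := ih (by omega) v
      have es : s (t + 1) = x.plan.step (A t) (s t) := rfl
      by_cases ha : A t < x.m
      · have es' : s (t + 1) v = (x.plan.eff ⟨A t, ha⟩ v).getD (s t v) := by
          rw [es, SASPlus.step, dif_pos ha]; rfl
        have e1 := x.entry_eff ⟨A t, ha⟩ v
        simp only at e1
        refine ⟨fun l hl e => ?_, fun h => ?_⟩
        · cases he : x.plan.eff ⟨A t, ha⟩ v with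
          | none =>
            rw [he] at e1 es'
            rw [h9 t (by omega) l hl v v.2 e (Or.inr e1), ih.1 l hl e, es']
            rfl
          | some d =>
            rw [he] at e1 es'
            rw [h8 t (by omega) ha l hl v v.2 e (by rw [e1]; simp [codeOption]), e1, es']
            rfl
        · rw [es', (untouched t (by omega) ha v h).1]
          exact ih.2 h
      · have es' : s (t + 1) = s t := by rw [es, SASPlus.step, dif_neg ha]
        rw [es']
        refine ⟨fun l hl e => ?_, ih.2⟩
        rw [h9 t (by omega) l hl v v.2 e (Or.inl ha), ih.1 l hl e]
  have valid : x.plan.ValidWalk A x.plan.init x.k := by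
    intro t ht ha v
    by_cases hp : x.plan.pre ⟨A t, ha⟩ v = none
    · exact Or.inr hp
    · left
      rcases gap v with ⟨l, hl, e⟩ | ⟨h, -⟩
      · have e2 := x.entry_pre ⟨A t, ha⟩ v
        simp only at e2
        have := h7 t ht ha l hl v v.2 e (by rwa [e2, Ne, codeOption_eq_zero])
        rw [(inv t ht.le v).1 l hl e, e2] at this
        exact codeOption_eq_succ.1 this.symm
      · rw [(untouched t ht ha v h).2 hp]
        exact congrArg some ((inv t ht.le v).2 h).symm
  obtain ⟨π, hπ, hp⟩ := x.plan.exists_plan_of_validWalk valid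
  refine ⟨π, hπ, _, fun v => ?_, hp⟩
  by_cases hg : x.plan.goal v = none
  · exact Or.inr hg
  · left
    rcases gap v with ⟨l, hl, e⟩ | ⟨h, l, hl, hl1⟩
    · have := h6 l hl v v.2 e (by rwa [x.entry_goal, Ne, codeOption_eq_zero])
      rw [(inv x.k le_rfl v).1 l hl e, x.entry_goal] at this
      exact codeOption_eq_succ.1 this.symm
    · have h' := h3 l hl
      simp only [GoalGap, not_exists, not_and, not_not] at h'
      have h'' := h' v v.2 hl1
      rw [x.entry_goal, codeOption_eq_zero, x.entry_init, codeOption_eq_succ] at h''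
      rw [h'' hg]
      exact congrArg some ((inv x.k le_rfl v).2 h).symm

/-! ### From a plan to the constraints. -/

/-- The first element of `T` from `y` on, or else `n`, plus one. -/
noncomputable def nextTracked (T : Finset ℕ) (n y : ℕ) : ℕ :=
  sInf {z | z ∈ T ∧ y ≤ z ∨ z = n} + 1

/-- The increasing enumeration of the successors of the elements of `T`, between `0` and `n + 1`. -/
noncomputable def tracked (T : Finset ℕ) (n : ℕ) : ℕ → ℕ
  | 0 => 0
  | l + 1 => nextTracked T n (tracked T n l)

theorem nextTracked_le {T : Finset ℕ} {n y z : ℕ} (h : z ∈ T ∧ y ≤ z ∨ z = n) :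
    nextTracked T n y ≤ z + 1 := Nat.succ_le_succ (Nat.sInf_le h)

theorem nextTracked_spec (T : Finset ℕ) (n y : ℕ) :
    (∃ z ∈ T, y ≤ z ∧ nextTracked T n y = z + 1) ∨ nextTracked T n y = n + 1 := by
  have h : sInf {z | z ∈ T ∧ y ≤ z ∨ z = n} ∈ {z | z ∈ T ∧ y ≤ z ∨ z = n} :=
    Nat.sInf_mem ⟨n, Or.inr rfl⟩
  rcases h with h | h
  · exact Or.inl ⟨_, h.1, h.2, rfl⟩
  · exact Or.inr (congrArg (· + 1) h)

theorem tracked_le (T : Finset ℕ) (n l : ℕ) : tracked T n l ≤ n + 1 := by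
  cases l with
  | zero => exact Nat.zero_le _
  | succ l => exact nextTracked_le (Or.inr rfl)

theorem tracked_no_gap {T : Finset ℕ} {n l z : ℕ} (hz : z ∈ T) (h1 : tracked T n l < z + 1) :
    ¬ z + 1 < tracked T n (l + 1) := by
  have : tracked T n (l + 1) ≤ z + 1 := nextTracked_le (Or.inl ⟨hz, by omega⟩)
  omega

/-- Every step passes an element of `T` or reaches the sentinel, beyond which there are none. So at
most `k - l` elements remain after `l` steps, and the step after the `k`-th goes to `n + 1`. -/
theorem tracked_last {T : Finset ℕ} {n k : ℕ} (hT : ∀ z ∈ T, z < n) (hk : T.card ≤ k) :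
    tracked T n (k + 1) = n + 1 := by
  have h : ∀ l, (T.filter fun z => tracked T n l ≤ z).card ≤ k - l := by
    intro l
    induction l with
    | zero => exact (Finset.card_filter_le _ _).trans hk
    | succ l ih =>
      rcases nextTracked_spec T n (tracked T n l) with ⟨z, hz, hz1, e⟩ | e
      · have hlt : (T.filter fun z => tracked T n (l + 1) ≤ z).card <
            (T.filter fun z => tracked T n l ≤ z).card := by
          apply Finset.card_lt_card
          rw [Finset.ssubset_iff_of_subset]
          · refine ⟨z, by simp [hz, hz1], ?_⟩
            simp [tracked, e]
          · intro z' hz'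
            simp only [Finset.mem_filter, tracked, e] at hz' ⊢
            exact ⟨hz'.1, by omega⟩
        omega
      · have : (T.filter fun z => tracked T n (l + 1) ≤ z) = ∅ := by
          apply Finset.filter_eq_empty_iff.2
          intro z hz
          have := hT z hz
          simp only [tracked, e]
          omega
        rw [this]
        exact Nat.zero_le _
  have h' := h k
  rw [Nat.sub_self, Nat.le_zero, Finset.card_eq_zero, Finset.filter_eq_empty_iff] at h'
  rcases nextTracked_spec T n (tracked T n k) with ⟨z, hz, hz1, -⟩ | e
  · exact absurd hz1 (h' hz)
  · exact e

/-- Let `T` be the set of variables affected along the walk. By restriction U each step contributes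
at most one. A violated gap condition would exhibit a variable that is affected or must differ from
its initial value; such a variable is in `T`, and `tracked` never steps over `T`. -/
theorem exists_planConstraints {x : PlanningInstance} (hU : x.plan.RestrictionU)
    (hx : x.Solvable) : ∃ (A V : ℕ → ℕ) (Z : ℕ → ℕ → ℕ),
      (∀ t < bound x.numbers, A t < numValues x.numbers) ∧
      (∀ l < bound x.numbers + 2, V l < numValues x.numbers) ∧
      (∀ t < bound x.numbers + 1, ∀ l < bound x.numbers + 2, Z t l < numValues x.numbers) ∧
      PlanConstraints x.numbers A V Z := by
  classical
  obtain ⟨π, hπ, s', hs', hp⟩ := hx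
  obtain ⟨A, hA, valid, hend⟩ := x.plan.exists_validWalk_of_plan hπ hp
  set s := x.plan.walk A x.plan.init with hs
  choose w hw hw' using hU
  let T : Finset ℕ := (Finset.range x.k).biUnion fun t =>
    if h : A t < x.m then {(w ⟨A t, h⟩ : ℕ)} else ∅
  have hT : ∀ z ∈ T, z < x.n := by
    intro z hz
    simp only [T, Finset.mem_biUnion] at hz
    obtain ⟨t, -, hz⟩ := hz
    split_ifs at hz with h
    · rw [Finset.mem_singleton] at hz
      rw [hz]; exact (w _).2
    · simp at hz
  have hTk : T.card ≤ x.k := by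
    have := Finset.card_biUnion_le_card_mul (Finset.range x.k)
      (fun t => if h : A t < x.m then {(w ⟨A t, h⟩ : ℕ)} else ∅) 1 (fun t _ => by
        split_ifs <;> simp)
    simpa using this
  have touched : ∀ t < x.k, ∀ ha : A t < x.m, ∀ v : Fin x.n, x.plan.eff ⟨A t, ha⟩ v ≠ none →
      (v : ℕ) ∈ T := by
    intro t ht ha v hv
    refine Finset.mem_biUnion.2 ⟨t, Finset.mem_range.2 ht, ?_⟩
    rw [dif_pos ha, Finset.mem_singleton, hw' _ v hv]
  have unchanged : ∀ v : Fin x.n, (v : ℕ) ∉ T → ∀ t ≤ x.k, s t v = x.plan.init v := by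
    intro v hv t ht
    induction t with
    | zero => rfl
    | succ t ih =>
      rw [← ih (by omega)]
      have es : s (t + 1) = x.plan.step (A t) (s t) := rfl
      rw [es, SASPlus.step]
      split_ifs with ha
      · have : x.plan.eff ⟨A t, ha⟩ v = none := by
          by_contra e
          exact hv (touched t (by omega) ha v e)
        simp [SASPlus.result, this]
      · rfl
  let V := tracked T x.n
  -- The constraints read `Z` only at positions that track a variable, so the value at the sentinels
  -- is arbitrary.
  let Z : ℕ → ℕ → ℕ := fun t l => if h : ∃ v : Fin x.n, V l = v + 1 then s t h.choose + 1 else 0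
  have hZ : ∀ t l, ∀ v : Fin x.n, V l = v + 1 → Z t l = s t v + 1 := by
    intro t l v e
    have h : ∃ v : Fin x.n, V l = v + 1 := ⟨v, e⟩
    have e' : h.choose = v := Fin.ext (by have := h.choose_spec; omega)
    simp only [Z, dif_pos h, e']
  have hS : numValues x.numbers = x.n + x.d + x.m + 2 := rfl
  refine ⟨A, V, Z, fun t _ => ?_, fun l _ => ?_, fun t _ l _ => ?_, ?_⟩
  · have := hA t
    omega
  · have : V l ≤ x.n + 1 := tracked_le _ _ _
    omega
  · simp only [Z]
    split_ifs with h
    · have := (s t h.choose).2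
      omega
    · omega
  · constructor
    · rfl
    · exact tracked_last hT hTk
    · rintro l hl ⟨v, hv, ⟨hv1, hv2⟩, hg, hg'⟩
      lift v to Fin x.n using hv
      rw [x.entry_goal] at hg hg'
      rw [codeOption_eq_zero] at hg
      rw [x.entry_init, codeOption_eq_succ] at hg'
      refine tracked_no_gap (by_contra fun hvT => hg' ?_) hv1 hv2
      rw [(hs' v).resolve_right hg, ← hend, unchanged v hvT x.k le_rfl]
    · rintro t ht ha l hl ⟨v, hv, ⟨hv1, hv2⟩, hg⟩
      lift v to Fin x.n using hv
      have e1 := x.entry_eff ⟨A t, ha⟩ v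
      have e2 := x.entry_pre ⟨A t, ha⟩ v
      simp only at e1 e2
      rw [e1, e2, x.entry_init, codeOption_eq_zero, codeOption_eq_zero, codeOption_eq_succ] at hg
      refine tracked_no_gap ?_ hv1 hv2
      rcases hg with hg | ⟨hg, hg'⟩
      · exact touched t ht ha v hg
      · refine by_contra fun hvT => hg' ?_
        rw [(valid t ht ha v).resolve_right hg]
        exact congrArg some (unchanged v hvT t (le_of_lt ht))
    · intro l hl v hv e
      lift v to Fin x.n using hv
      rw [hZ 0 l v e, x.entry_init]; rfl
    · intro l hl v hv e hg
      lift v to Fin x.n using hv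
      rw [x.entry_goal] at hg ⊢
      rw [hZ _ l v e, (hs' v).resolve_right (by rwa [Ne, codeOption_eq_zero] at hg), ← hend]
      rfl
    · intro t ht ha l hl v hv e hg
      lift v to Fin x.n using hv
      have e2 := x.entry_pre ⟨A t, ha⟩ v
      simp only at e2
      rw [e2] at hg ⊢
      rw [hZ _ l v e, (valid t ht ha v).resolve_right (by rwa [Ne, codeOption_eq_zero] at hg)]
      rfl
    · intro t ht ha l hl v hv e hg
      lift v to Fin x.n using hv
      have e2 := x.entry_eff ⟨A t, ha⟩ v
      simp only at e2
      rw [e2] at hg ⊢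
      rw [hZ _ l v e]
      have es : s (t + 1) v = (x.plan.eff ⟨A t, ha⟩ v).getD (s t v) := by
        rw [show s (t + 1) = x.plan.step (A t) (s t) from rfl, SASPlus.step,
          dif_pos (show A t < x.m from ha)]; rfl
      rw [es]
      cases he : x.plan.eff ⟨A t, ha⟩ v with
      | none => rw [he] at hg; exact absurd rfl hg
      | some d => rfl
    · intro t ht l hl v hv e hg
      lift v to Fin x.n using hv
      rw [hZ _ l v e, hZ _ l v e]
      have es : s (t + 1) = x.plan.step (A t) (s t) := rfl
      rw [es, SASPlus.step]
      split_ifs with ha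
      · have e2 := x.entry_eff ⟨A t, ha⟩ v
        simp only at e2
        have := hg.resolve_left (not_not.2 ha)
        rw [e2, codeOption_eq_zero] at this
        simp [SASPlus.result, this]
      · rfl

theorem solvable_iff_satInstance {x : PlanningInstance} (hU : x.plan.RestrictionU) :
    x.Solvable ↔ (satInstance x.numbers).Solvable := by
  rw [satInstance_solvable_iff_constraints]
  exact ⟨exists_planConstraints hU, fun ⟨_, _, _, _, _, _, H⟩ => H.solvable⟩

theorem length_clause_satInstance (L : List ℕ) : ∀ C ∈ (satInstance L).formula, C.length ≤ 4 := by
  intro C hC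
  obtain ⟨D, hD, rfl⟩ := List.mem_map.1 hC
  exact (List.length_map _).trans_le (bound_clauses L D hD).1

/-- The parameter of the weighted satisfiability instance is a computable function. -/
theorem computable_numSlots : Computable fun k : ℕ => (k + 3) * (k + 2) :=
  (Primrec.nat_mul.comp (Primrec.nat_add.comp .id (.const 3))
    (Primrec.nat_add.comp .id (.const 2))).to_comp

theorem boundedSASPlanning_restrictionU_mem_W1 :
    boundedSASPlanning (fun x => x.plan.RestrictionU) ∈ W1 := by
  obtain ⟨M, hM, c, hc⟩ := emit_outputCode.exists_machine
  -- The running time is polynomial in the size alone, so its parameter factor is the constant `1`.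
  refine ⟨4, fun x => ⟨satInstance x.1.numbers, length_clause_satInstance _⟩,
    fun x => solvable_iff_satInstance x.2,
    ⟨_, computable_numSlots, fun x => le_rfl⟩, M, hM, fun _ => 1, c, .const 1, fun x => ?_⟩
  -- The four leading numbers alone contribute four separators, so the size is at least 2.
  have h := hc x.1.numbers (by simp [PlanningInstance.numbers]; omega)
  rw [← code_satInstance, ← PlanningInstance.code_eq] at h
  rw [one_mul]
  exact h

end BoundedPlanning

theorem mainTheorem5 :
    BoundedPlanning.boundedSASPlanning (fun x => x.plan.RestrictionU) ∈ BoundedPlanning.W1 := by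
  exact BoundedPlanning.boundedSASPlanning_restrictionU_mem_W1
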